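/- **Setting.** Let $\mathbb K\subset\mathbb C$ be a field, $\mathbf f=(f_1,\dots,f_N)\in\mathbb K[x_1,\dots,x_n]^N$, and let $\xi\in\mathbb C^n$ be an isolated root of $\mathbf f$. Let $I=\langle f_1,\dots,f_N\rangle\subset\mathbb C[\mathbf x]$, let $Q$ be the primary component of $I$ at $\xi$, $\delta=\dim_{\mathbb C}\mathbb C[\mathbf x]/Q$, and let $\mathscr D=I^{\perp}\cap\mathbb C[\partial_\xi]$ be the space of those polynomial differential operators evaluated at $\xi$ that vanish on $I$. The order $\mathrm{ord}(\Lambda)$ of $\Lambda\in\mathscr D$ is its degree in $\partial$. Fix an orthogonal primal-dual pair of bases: a basis $\{(\mathbf x-\xi)^{\alpha_0},\dots,(\mathbf x-\xi)^{\alpha_{\delta-1}}\}$ of $\mathbb C[\mathbf x]/Q$ with $\alpha_0=0$ that is connected to $1$ (each $\alpha_k\ne 0$ is $\alpha_l+\mathbf e_i$ for some $l,i$), and $\Lambda_0=1_\xi,\Lambda_1,\dots,\Lambda_{\delta-1}\in\mathscr D$ with $\Lambda_j((\mathbf x-\xi)^{\alpha_k})=\delta_{jk}$, $\mathrm{ord}(\Lambda_0)\le\dots\le\mathrm{ord}(\Lambda_{\delta-1})$,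 and, for every $t\ge 0$, $\{\Lambda\in\mathscr D:\mathrm{ord}(\Lambda)\le t\}=\mathrm{span}\{\Lambda_j:\mathrm{ord}(\Lambda_j)\le t\}$. Write $\Lambda_j=\sum_\beta \nu_{\alpha_j,\beta}\,\frac1{\beta!}\partial_\xi^\beta$. Let $E=\{\alpha_0,\dots,\alpha_{\delta-1}\}$ and $\partial(E)=\bigcup_i(E+\mathbf e_i)\setminus E$. For $i=1,\dots,n$ the parametric multiplication matrix $\mathtt M_i(\mu)$ is the strictly lower triangular $\delta\times\delta$ matrix whose entry in row $j$ and column $k<j$ is $1$ if $\alpha_k+\mathbf e_i=\alpha_j$, is $0$ if $\alpha_k+\mathbf e_i\in E\setminus\{\alpha_j\}$, and is the variable $\mu_{\alpha_j,\alpha_k+\mathbf e_i}$ if $\alpha_k+\mathbf e_i\notin E$. The vector $\mu$ consists of the variables $\mu_{\alpha,\beta}$, $(\alpha,\beta)\in E\times\partial(E)$, that occur in these matrices; equal index pairs give the same variable. Let $\nu$ be the vector of the corresponding $\nu_{\alpha,\beta}$, and let $m$ be the number of variables $(\mathbf z,\mu)=(z_1,\dots,z_n,\mu)$. Put $\mathtt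 M(\mu)^\gamma=\mathtt M_1(\mu)^{\gamma_1}\cdots\mathtt M_n(\mu)^{\gamma_n}$ and, with $[1]=(1,0,\dots,0)^t$, $$\mathcal N_{\mathbf z,\mu}(p)=\sum_{\gamma}\frac1{\gamma!}\,\partial_{\mathbf z}^\gamma(p)\,\mathtt M(\mu)^\gamma[1]\in\mathbb K[\mathbf z,\mu]^\delta .$$ Let $P_1,\dots,P_M\in\mathbb K[\mathbf z,\mu]$ be all the entries of $$\mathcal N_{\mathbf z,\mu}(f_k)\ (k=1,\dots,N),\qquad \mathtt M_i(\mu)\mathtt M_j(\mu)-\mathtt M_j(\mu)\mathtt M_i(\mu)\ (i,j=1,\dots,n).$$ For $R\in\mathbb C^{m\times M}$ let $R\cdot P$ be the square subsystem of the $m$ linear combinations $\sum_e R_{v,e}P_e$. A simple root is an isolated root of multiplicity one. **Corollary.** 1. There is a nonzero polynomial $D$ of total degree at most $m$ in the entries of $R$ such that, whenever $D(R)\ne0$, the square system $R\cdot P$ has $(\mathbf z,\mu)=(\xi,\nu)$ as a simple root. In particular this holds for Lebesgue-almost every $R\in\mathbb C^{m\times M}$. Moreover, some $m$ of the equations $P_e$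 already form a square system with $(\xi,\nu)$ as a simple root. 2. For each $R$ such that $G=R\cdot P$ has the simple root $x^*=(\xi,\nu)$, Newton's method for $G$ converges quadratically to $x^*$ from all sufficiently good approximations: there are $r,c>0$ such that, for every start $y^{(0)}=(\tilde\xi,\tilde\nu)$ with $\|y^{(0)}-x^*\|<r$, the Jacobian matrix of $G$ is invertible at all Newton iterates $y^{(l)}$, and $\|y^{(l+1)}-x^*\|\le c\,\|y^{(l)}-x^*\|^2$ and $\|y^{(l)}-x^*\|\le(\tfrac12)^{2^l-1}\|y^{(0)}-x^*\|$ for all $l\ge 0$. (Here $\|\cdot\|$ is the maximum norm.) Moreover, for all $j$ and $\gamma\in\mathbb N^n$, the $j$-th entry of the first column of $\mathtt M(\mu^{(l)})^\gamma$, where $\mu^{(l)}$ is the $\mu$-part of $y^{(l)}$, tends to $\nu_{\alpha_j,\gamma}$ as $l\to\infty$. 3. The entry of $\mathtt M_i(\nu)$ in row $j$ and column $k$ is $\nu_{\alpha_j,\alpha_k+\mathbf e_i}$ for all $i,j,k$, and for all $j$ and all $\gamma\in\mathbb N^n$ the coefficient $\nu_{\alpha_j,\gamma}$ is the $j$-th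 entry of the first column $\mathtt M(\nu)^\gamma[1]$. -/

import Mathlib

open MvPolynomial Filter Topology

noncomputable section

namespace MultStruct

/-- `∂^β = ∂₁^β₁ ⋯ ∂ₙ^βₙ` acting on polynomials in `n` variables. -/
def iterPderiv {R : Type*} [CommRing R] {n : ℕ} (β : Fin n →₀ ℕ) :
    MvPolynomial (Fin n) R →ₗ[R] MvPolynomial (Fin n) R :=
  ((List.ofFn fun i : Fin n =>
    ((pderiv i).toLinearMap : Module.End R (MvPolynomial (Fin n) R)) ^ β i).prod :
      Module.End R (MvPolynomial (Fin n) R))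

/-- The multi-index factorial `β! = β₁! ⋯ βₙ!`. -/
def multiFactorial {n : ℕ} (β : Fin n →₀ ℕ) : ℕ := ∏ i, (β i).factorial

/-- The monomial `(x - ξ)^β`. -/
def shiftedMonomial {n : ℕ} (ξ : Fin n → ℂ) (β : Fin n →₀ ℕ) : MvPolynomial (Fin n) ℂ :=
  ∏ i, (X i - C (ξ i)) ^ β i

/-- The identification of a polynomial `Λ(∂) = ∑ c_β ∂^β` (its variables standing for
`∂₁, …, ∂ₙ`) with the linear functional `p ↦ ∑ c_β (∂^β p)(ξ)` on `ℂ[x]`. -/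
def diffFunctional {n : ℕ} (ξ : Fin n → ℂ) :
    MvPolynomial (Fin n) ℂ →ₗ[ℂ] Module.Dual ℂ (MvPolynomial (Fin n) ℂ) :=
  (basisMonomials (Fin n) ℂ).constr ℂ fun β =>
    (aeval ξ : MvPolynomial (Fin n) ℂ →ₐ[ℂ] ℂ).toLinearMap ∘ₗ iterPderiv β

/-- `x` is a root of the system `F`, isolated in the Euclidean topology. -/
def IsIsolatedRoot {σ ι : Type*} (F : ι → MvPolynomial σ ℂ) (x : σ → ℂ) : Prop :=
  (∀ i, eval x (F i) = 0) ∧ ∀ᶠ y in 𝓝 x, (∀ i, eval y (F i) = 0) → y = x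

/-- The contraction to `ℂ[x]` of the extension of `I` to the local ring of `ℂ[x]` at `x`:
all `q` with `p q ∈ I` for some `p` not vanishing at `x`. At an isolated root `x` of `I` it is
the primary component of `I` whose radical is the maximal ideal of `x`. -/
def primaryComponent {σ : Type*} (I : Ideal (MvPolynomial σ ℂ)) (x : σ → ℂ) :
    Ideal (MvPolynomial σ ℂ) where
  carrier := {q | ∃ p, eval x p ≠ 0 ∧ p * q ∈ I}
  zero_mem' := ⟨1, by simp, by simp⟩
  add_mem' := by
    rintro a b ⟨p, hp, hpa⟩ ⟨q, hq, hqb⟩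
    refine ⟨p * q, by simp [hp, hq], ?_⟩
    have h : p * q * (a + b) = q * (p * a) + p * (q * b) := by ring
    rw [h]
    exact I.add_mem (I.mul_mem_left _ hpa) (I.mul_mem_left _ hqb)
  smul_mem' := by
    rintro c a ⟨p, hp, hpa⟩
    refine ⟨p, hp, ?_⟩
    have h : p * (c • a) = c * (p * a) := by rw [smul_eq_mul]; ring
    rw [h]
    exact I.mul_mem_left _ hpa

/-- The multiplicity of the system `F` at `x`: the dimension of `ℂ[x]/Q`, where `Q` is the
primary component at `x` of the ideal generated by `F`. -/
def multiplicity {σ ι : Type*} (F : ι → MvPolynomial σ ℂ) (x : σ → ℂ) : ℕ :=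
  Module.finrank ℂ (MvPolynomial σ ℂ ⧸ primaryComponent (Ideal.span (Set.range F)) x)

/-- A simple root: an isolated root of multiplicity one. -/
def IsSimpleRoot {σ ι : Type*} (F : ι → MvPolynomial σ ℂ) (x : σ → ℂ) : Prop :=
  IsIsolatedRoot F x ∧ multiplicity F x = 1

/-- The inverse system `𝒟 = I^⊥ ∩ ℂ[∂_ξ]`, where `I` is the ideal generated by `F`. -/
def inverseSystem {n : ℕ} {ι : Type*} (F : ι → MvPolynomial (Fin n) ℂ) (ξ : Fin n → ℂ) :
    Submodule ℂ (MvPolynomial (Fin n) ℂ) :=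
  (((Ideal.span (Set.range F)).restrictScalars ℂ).dualAnnihilator).comap (diffFunctional ξ)

/-- Orthogonal primal-dual basis pair of the local ring of `F` at `ξ`. The primal basis is
`B = {(x-ξ)^α₀, …, (x-ξ)^α_{δ-1}}`, with exponent set `E = {α₀, …, α_{δ-1}}`, and the dual basis
is `Λ₀, …, Λ_{δ-1}`, whose orders are their total degrees in `∂`. -/
structure IsPrimalDualPair {n δ : ℕ} [NeZero δ] {ι : Type*}
    (F : ι → MvPolynomial (Fin n) ℂ) (ξ : Fin n → ℂ)
    (α : Fin δ → Fin n →₀ ℕ) (Λ : Fin δ → MvPolynomial (Fin n) ℂ) : Prop where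
  /-- `B` is a basis of `ℂ[x]/Q`: independence. -/
  linearIndependent : LinearIndependent ℂ fun k =>
    Ideal.Quotient.mk (primaryComponent (Ideal.span (Set.range F)) ξ) (shiftedMonomial ξ (α k))
  /-- `B` is a basis of `ℂ[x]/Q`: generation. -/
  span_eq_top : Submodule.span ℂ (Set.range fun k =>
    Ideal.Quotient.mk (primaryComponent (Ideal.span (Set.range F)) ξ)
      (shiftedMonomial ξ (α k))) = ⊤
  /-- The first exponent is `0`. -/
  exponent_zero : α 0 = 0
  /-- `B` is connected to `1`. -/
  connected : ∀ k, α k ≠ 0 → ∃ l i, α k = α l + Finsupp.single i 1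
  /-- The dual basis consists of elements of `𝒟`. -/
  mem_inverseSystem : ∀ j, Λ j ∈ inverseSystem F ξ
  /-- `Λ₀` is the evaluation at `ξ`. -/
  dual_zero : Λ 0 = 1
  /-- The dual basis is orthogonal to `B`. -/
  orthogonal : ∀ j k, diffFunctional ξ (Λ j) (shiftedMonomial ξ (α k)) = if j = k then 1 else 0
  /-- The orders of the dual basis elements are nondecreasing. -/
  ord_mono : Monotone fun j => (Λ j).totalDegree
  /-- The elements of `𝒟` of order at most `t` are spanned by the `Λ_j` of order at most `t`. -/
  filtration : ∀ t : ℕ, inverseSystem F ξ ⊓ restrictTotalDegree (Fin n) ℂ t =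
    Submodule.span ℂ {L | ∃ j, Λ j = L ∧ (Λ j).totalDegree ≤ t}

/-- The coefficient `ν_{α_j, β}` of `Λ_j = ∑_β ν_{α_j, β} ∂^β / β!`. -/
def dualCoeff {n δ : ℕ} (Λ : Fin δ → MvPolynomial (Fin n) ℂ) (j : Fin δ) (β : Fin n →₀ ℕ) : ℂ :=
  (multiFactorial β : ℂ) * coeff β (Λ j)

/-- The index set of the parameters `μ_{α_j, β}`: the pairs `(α_j, β)` with `β ∈ ∂(E)` that label
an entry strictly above the diagonal of some matrix `M_i(μ)ᵗ`, that is `β ∉ E` and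
`β = α_k + e_i` with `k < j`. -/
abbrev ParamIndex {n δ : ℕ} (α : Fin δ → Fin n →₀ ℕ) : Type :=
  {q : Fin δ × (Fin n →₀ ℕ) //
    (¬ ∃ l, α l = q.2) ∧ ∃ k, k < q.1 ∧ ∃ i, q.2 = α k + Finsupp.single i 1}

instance finite_paramIndex {n δ : ℕ} (α : Fin δ → Fin n →₀ ℕ) : Finite (ParamIndex α) := by
  refine Set.Finite.subset (Set.finite_range fun t : Fin δ × Fin δ × Fin n =>
    ((t.1, α t.2.1 + Finsupp.single t.2.2 1) : Fin δ × (Fin n →₀ ℕ))) ?_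
  rintro ⟨j, β⟩ ⟨-, k, -, i, h⟩
  exact ⟨(j, k, i), Prod.ext rfl h.symm⟩

instance fintypeParamIndex {n δ : ℕ} (α : Fin δ → Fin n →₀ ℕ) : Fintype (ParamIndex α) :=
  Fintype.ofFinite _

/-- The variables `(z, μ)` of the deflated system. -/
abbrev Var {n δ : ℕ} (α : Fin δ → Fin n →₀ ℕ) : Type := Fin n ⊕ ParamIndex α

/-- The parametric multiplication matrix `M_i(μ)`: the entry in row `j` and column `k` is the
array entry `μ_{α_j, α_k + e_i}` if `k < j`, and `0` otherwise. -/
def paramMatrix (K : Type*) [Field K] {n δ : ℕ} (α : Fin δ → Fin n →₀ ℕ) (i : Fin n) :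
    Matrix (Fin δ) (Fin δ) (MvPolynomial (Var α) K) :=
  Matrix.of fun j k =>
    if hk : k < j then
      if α j = α k + Finsupp.single i 1 then 1
      else if hE : ∃ l, α l = α k + Finsupp.single i 1 then 0
      else X (Sum.inr ⟨(j, α k + Finsupp.single i 1), hE, k, hk, i, rfl⟩)
    else 0

/-- `M(μ)^γ = M₁(μ)^γ₁ ⋯ Mₙ(μ)^γₙ`, in this order. -/
def paramMatrixPow (K : Type*) [Field K] {n δ : ℕ} (α : Fin δ → Fin n →₀ ℕ) (γ : Fin n →₀ ℕ) :
    Matrix (Fin δ) (Fin δ) (MvPolynomial (Var α) K) :=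
  (List.ofFn fun i : Fin n => paramMatrix K α i ^ γ i).prod

/-- The parametric normal form `∑_γ (1/γ!) ∂_z^γ(p) M(μ)^γ[1]`, where `[1] = (1, 0, …, 0)`. The sum
is over `|γ| < δ`: the matrices `M_i(μ)` are strictly lower triangular of size `δ`, so that
`M(μ)^γ = 0` for `|γ| ≥ δ`. -/
def paramNormalForm {K : Type*} [Field K] {n δ : ℕ} [NeZero δ] (α : Fin δ → Fin n →₀ ℕ)
    (p : MvPolynomial (Fin n) K) (j : Fin δ) : MvPolynomial (Var α) K :=
  ∑ d ∈ Finset.range δ, ∑ γ ∈ (Finset.univ : Finset (Fin n)).finsuppAntidiag d,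
    C ((multiFactorial γ : K)⁻¹) * rename Sum.inl (iterPderiv γ p) * paramMatrixPow K α γ j 0

/-- Labels of the equations of the deflated system: the `δ` entries of the normal forms of
`f₁, …, f_N`, and the entries of the commutators. -/
abbrev Eqn (n N δ : ℕ) : Type := (Fin N × Fin δ) ⊕ ((Fin n × Fin n) × Fin δ × Fin δ)

/-- The overdetermined deflated system in `K[z, μ]`. -/
def deflatedSystem {K : Type*} [Field K] {n N δ : ℕ} [NeZero δ]
    (f : Fin N → MvPolynomial (Fin n) K) (α : Fin δ → Fin n →₀ ℕ) :
    Eqn n N δ → MvPolynomial (Var α) K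
  | Sum.inl (k, j) => paramNormalForm α (f k) j
  | Sum.inr ((a, b), j, k) =>
      (paramMatrix K α a * paramMatrix K α b - paramMatrix K α b * paramMatrix K α a) j k

/-- The point `(z, μ) = (ξ, ν)`. -/
def rootPoint {n δ : ℕ} (ξ : Fin n → ℂ) (α : Fin δ → Fin n →₀ ℕ)
    (Λ : Fin δ → MvPolynomial (Fin n) ℂ) : Var α → ℂ :=
  Sum.elim ξ fun q => dualCoeff Λ q.1.1 q.1.2

/-- The square system `R · P` of the linear combinations of the equations `P`, with one row of
coefficients for each variable. -/
def squareSubsystem {σ ε : Type*} [Fintype ε] (P : ε → MvPolynomial σ ℂ) (R : σ → ε → ℂ) :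
    σ → MvPolynomial σ ℂ :=
  fun v => ∑ e, C (R v e) * P e

/-- The Jacobian matrix of a square system at a point. -/
def jacobianAt {σ : Type*} (G : σ → MvPolynomial σ ℂ) (x : σ → ℂ) : Matrix σ σ ℂ :=
  Matrix.of fun a b => eval x (pderiv b (G a))

/-- One step of Newton's method for a square system. -/
def newtonStep {σ : Type*} [Fintype σ] [DecidableEq σ] (G : σ → MvPolynomial σ ℂ)
    (x : σ → ℂ) : σ → ℂ :=
  x - (jacobianAt G x)⁻¹.mulVec fun a => eval x (G a)

end MultStruct

end

/-! Everything rests on one fact: the Jacobian of the overdetermined system at `(ξ, ν)` has trivial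
kernel (`jacobian_injective`). Some `m` of its rows then form an invertible matrix, `det (R * J)` is
a nonzero polynomial in `R`, and an invertible Jacobian gives a simple root.

At `μ = ν` the parametric matrices become the matrices `M_i` of multiplication by `x_i - ξ_i` on
`ℂ[x]/Q`, because `∂/∂(∂_i)` acting on the inverse system is dual to that multiplication. They
commute, and the order filtration makes them strictly lower triangular. The parametric normal form
is the first column of the matrix `p(z + M)`, and `p ↦ p(z + M)` is multiplicative for commuting
nilpotent `M_i` over any commutative `ℂ`-algebra.

A kernel vector of the Jacobian is a solution over the dual numbers: `z = ξ + ε v`, `A_i = M_i + ε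
M_i'`. The deformed normal form kills `F`, hence `Q`, so it factors through `ℂ[x]/Q` as `1 + ε T`.
Multiplication by `x_i` gives `T M_i = v_i + M_i T + M_i'`. Taking traces gives `v = 0`. Since `T`
kills the class of `1` and the basis is connected to `1`, with constant entries of the matrices
along the connecting steps, `T = 0` column by column. Then `M_i' = 0`, and the kernel vector
vanishes. -/

noncomputable section

namespace MultStruct

/-! ### Ordered products of powers. -/

section MultiPow

variable {A : Type*} [Monoid A]

/-- The ordered product `a₁^γ₁ ⋯ aₙ^γₙ`. -/
def multiPow {n : ℕ} (a : Fin n → A) (γ : Fin n → ℕ) : A :=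
  (List.ofFn fun i => a i ^ γ i).prod

theorem multiPow_succ {n : ℕ} (a : Fin (n + 1) → A) (γ : Fin (n + 1) → ℕ) :
    multiPow a γ = a 0 ^ γ 0 * multiPow (fun i => a i.succ) (fun i => γ i.succ) := by
  simp [multiPow, List.ofFn_succ]

@[simp] theorem multiPow_zero {n : ℕ} (a : Fin n → A) : multiPow a 0 = 1 := by
  simp [multiPow]

theorem multiPow_add_piSingle {n : ℕ} (a : Fin n → A) (h : ∀ i j, Commute (a i) (a j))
    (γ : Fin n → ℕ) (i : Fin n) : multiPow a (γ + Pi.single i 1) = a i * multiPow a γ := by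
  induction n with
  | zero => exact i.elim0
  | succ n ih =>
    rw [multiPow_succ, multiPow_succ a γ]
    refine Fin.cases ?_ (fun i => ?_) i
    · have : (fun i : Fin n => (γ + Pi.single 0 1 : Fin (n + 1) → ℕ) i.succ) =
          fun i => γ i.succ := by
        funext i; simp
      rw [this]
      simp [pow_succ', mul_assoc]
    · have h1 : (fun k : Fin n => (γ + Pi.single i.succ 1 : Fin (n + 1) → ℕ) k.succ) =
          (fun k => γ k.succ) + Pi.single i 1 := by
        funext k
        by_cases hk : k = i
        · subst hk; simp
        · simp [hk]
      rw [h1, ih (fun i => a i.succ) (fun i j => h _ _), ← mul_assoc, ← mul_assoc]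
      congr 1
      simpa using ((h 0 i.succ).pow_left (γ 0)).eq

theorem multiPow_add_single {n : ℕ} {a : Fin n → A} (h : ∀ i j, Commute (a i) (a j))
    (γ : Fin n →₀ ℕ) (i : Fin n) :
    multiPow a (γ + Finsupp.single i 1 : Fin n →₀ ℕ) = a i * multiPow a γ := by
  rw [← multiPow_add_piSingle a h]
  congr 1
  funext k
  simp [Finsupp.single_apply, Pi.single_apply, eq_comm]

theorem map_multiPow {B F : Type*} [Monoid B] [FunLike F A B] [MonoidHomClass F A B] (φ : F)
    {n : ℕ} (a : Fin n → A) (γ : Fin n → ℕ) :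
    φ (multiPow a γ) = multiPow (fun i => φ (a i)) γ := by
  simp [multiPow, map_list_prod, List.map_ofFn, Function.comp_def]

end MultiPow

/-- Induction on exponents by adding unit vectors. -/
theorem exponent_induction {n : ℕ} {p : (Fin n →₀ ℕ) → Prop} (h0 : p 0)
    (hs : ∀ γ i, p γ → p (γ + Finsupp.single i 1)) (γ : Fin n →₀ ℕ) : p γ := by
  induction h : γ.degree generalizing γ with
  | zero => rwa [(Finsupp.degree_eq_zero_iff γ).1 h]
  | succ d ih =>
    have hne : γ ≠ 0 := by rintro rfl; simp at h
    obtain ⟨i, hi⟩ := Finsupp.ne_iff.1 hne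
    have hγ : γ - Finsupp.single i 1 + Finsupp.single i 1 = γ :=
      tsub_add_cancel_of_le (by simpa [Nat.one_le_iff_ne_zero] using hi)
    rw [← hγ]
    refine hs _ _ (ih _ ?_)
    rw [← hγ, map_add, Finsupp.degree_single] at h
    omega

/-! ### Iterated partial derivatives and multi-index factorials. -/

section Derivatives

variable {R : Type*} [CommRing R] {n : ℕ}

theorem iterPderiv_eq_multiPow (β : Fin n →₀ ℕ) :
    (iterPderiv β : Module.End R (MvPolynomial (Fin n) R)) =
    multiPow (fun i : Fin n => ((pderiv i).toLinearMap : Module.End R (MvPolynomial (Fin n) R)))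
      β := rfl

@[simp] theorem iterPderiv_zero (p : MvPolynomial (Fin n) R) : iterPderiv 0 p = p := by
  have h : (iterPderiv 0 : Module.End R (MvPolynomial (Fin n) R)) = 1 := by
    rw [iterPderiv_eq_multiPow, Finsupp.coe_zero, multiPow_zero]
  rw [h]; rfl

theorem pderiv_comm (i j : Fin n) (p : MvPolynomial (Fin n) R) :
    pderiv i (pderiv j p) = pderiv j (pderiv i p) := by
  have h : ⁅pderiv (R := R) i, pderiv (R := R) j⁆ = 0 := by
    apply MvPolynomial.derivation_ext
    intro k
    simp [Derivation.commutator_apply, pderiv_X, Pi.single_apply]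
    split_ifs <;> simp
  have := congrArg (fun d => d p) h
  simpa [Derivation.commutator_apply, sub_eq_zero] using this

theorem iterPderiv_add_single (β : Fin n →₀ ℕ) (i : Fin n) (p : MvPolynomial (Fin n) R) :
    iterPderiv (β + Finsupp.single i 1) p = pderiv i (iterPderiv β p) := by
  rw [iterPderiv_eq_multiPow, multiPow_add_single, ← iterPderiv_eq_multiPow]
  · rfl
  · exact fun i j => LinearMap.ext fun p => pderiv_comm i j p

/-- Leibniz rule: only the first derivative of `X i` survives, which gives the commutator of `∂^β`
with `x_i`. Truncated subtraction is harmless because its coefficient `β i` is then zero. Both the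
Taylor recursion and the duality of `∂` with multiplication come from this identity. -/
theorem iterPderiv_X_mul (β : Fin n →₀ ℕ) (i : Fin n) (p : MvPolynomial (Fin n) R) :
    iterPderiv β (X i * p) =
      X i * iterPderiv β p + β i • iterPderiv (β - Finsupp.single i 1) p := by
  induction β using exponent_induction with
  | h0 => simp
  | hs β k ih =>
    rw [iterPderiv_add_single, ih, iterPderiv_add_single, map_add, Derivation.leibniz, map_nsmul,
      ← iterPderiv_add_single (β - Finsupp.single i 1)]
    by_cases hk : k = i
    · subst hk
      have h1 : β k • iterPderiv (β - Finsupp.single k 1 + Finsupp.single k 1) p =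
          β k • iterPderiv β p := by
        by_cases h0 : β k = 0
        · simp [h0]
        · rw [tsub_add_cancel_of_le]
          simpa [Nat.one_le_iff_ne_zero] using h0
      rw [h1, add_tsub_cancel_right]
      simp [add_smul]
      ring
    · have h1 : β + Finsupp.single k 1 - Finsupp.single i 1 =
          β - Finsupp.single i 1 + Finsupp.single k 1 := by
        ext l
        by_cases hl : l = i
        · subst hl; simp [hk]
        · simp [Ne.symm hl]
      rw [h1]
      simp [pderiv_X, Ne.symm hk]

theorem iterPderiv_map {S : Type*} [CommRing S] (φ : R →+* S) (β : Fin n →₀ ℕ)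
    (p : MvPolynomial (Fin n) R) :
    iterPderiv β (map φ p) = map φ (iterPderiv β p) := by
  induction β using exponent_induction with
  | h0 => simp
  | hs β k ih => rw [iterPderiv_add_single, ih, iterPderiv_add_single, pderiv_map]

@[simp] theorem iterPderiv_one (β : Fin n →₀ ℕ) (hβ : β ≠ 0) :
    iterPderiv β (1 : MvPolynomial (Fin n) R) = 0 := by
  induction β using exponent_induction with
  | h0 => exact absurd rfl hβ
  | hs β k ih =>
    rw [iterPderiv_add_single]
    by_cases h : β = 0
    · subst h; simp
    · rw [ih h, map_zero]

theorem multiFactorial_add_single (β : Fin n →₀ ℕ) (i : Fin n) :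
    multiFactorial (β + Finsupp.single i 1) = (β i + 1) * multiFactorial β := by
  rw [multiFactorial, multiFactorial, ← Finset.mul_prod_erase _ _ (Finset.mem_univ i),
    ← Finset.mul_prod_erase (Finset.univ : Finset (Fin n)) (fun i => (β i).factorial)
      (Finset.mem_univ i), ← mul_assoc]
  congr 1
  · simp [Nat.factorial_succ]
  · refine Finset.prod_congr rfl fun k hk => ?_
    simp [(Finset.ne_of_mem_erase hk).symm]

theorem multiFactorial_ne_zero (β : Fin n →₀ ℕ) : multiFactorial β ≠ 0 :=
  Finset.prod_ne_zero_iff.2 fun _ _ => Nat.factorial_ne_zero _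

@[simp] theorem multiFactorial_zero : multiFactorial (0 : Fin n →₀ ℕ) = 1 := by
  simp [multiFactorial]

end Derivatives

/-! ### Matrices supported on and below a subdiagonal. -/

section LowerTriangular

variable {R : Type*} [CommRing R] {δ : ℕ}

/-- The entries of `A` vanish above the `d`-th subdiagonal. -/
def IsLowerBy (d : ℕ) (A : Matrix (Fin δ) (Fin δ) R) : Prop :=
  ∀ j k : Fin δ, (j : ℕ) < k + d → A j k = 0

theorem IsLowerBy.mul {d e : ℕ} {A B : Matrix (Fin δ) (Fin δ) R} (hA : IsLowerBy d A)
    (hB : IsLowerBy e B) : IsLowerBy (d + e) (A * B) := by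
  intro j k h
  rw [Matrix.mul_apply]
  refine Finset.sum_eq_zero fun l _ => ?_
  by_cases h1 : (j : ℕ) < l + d
  · rw [hA j l h1, zero_mul]
  · rw [hB l k (by omega), mul_zero]

theorem IsLowerBy.one : IsLowerBy 0 (1 : Matrix (Fin δ) (Fin δ) R) := by
  intro j k h
  exact Matrix.one_apply_ne (by rintro rfl; simp at h)

theorem IsLowerBy.eq_zero {d : ℕ} {A : Matrix (Fin δ) (Fin δ) R} (hA : IsLowerBy d A)
    (hd : δ ≤ d) : A = 0 := by
  ext j k
  exact hA j k (by omega)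

theorem IsLowerBy.pow {A : Matrix (Fin δ) (Fin δ) R} (hA : IsLowerBy 1 A) (a : ℕ) :
    IsLowerBy a (A ^ a) := by
  induction a with
  | zero => exact IsLowerBy.one
  | succ a ih => rw [pow_succ]; exact ih.mul hA

/-- Each factor pushes the support one subdiagonal down; hence truncating the normal form at `|γ| <
δ` loses nothing. -/
theorem IsLowerBy.multiPow {n : ℕ} {M : Fin n → Matrix (Fin δ) (Fin δ) R}
    (hM : ∀ i, IsLowerBy 1 (M i)) (γ : Fin n → ℕ) : IsLowerBy (∑ i, γ i) (multiPow M γ) := by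
  induction n with
  | zero => simpa [MultStruct.multiPow] using IsLowerBy.one
  | succ n ih =>
    rw [multiPow_succ, Fin.sum_univ_succ]
    exact ((hM 0).pow _).mul (ih (fun i => hM _) _)

end LowerTriangular

/-! ### The normal form as a polynomial evaluated at commuting matrices. -/

section NormalForm

variable {R : Type*} [CommRing R] [Algebra ℂ R] {n δ : ℕ}

/-- The matrix `p(z + M) = ∑_γ (1/γ!) (∂^γ p)(z) M^γ` given by the Taylor expansion of `p`. -/
def taylorMatrix (z : Fin n → R) (M : Fin n → Matrix (Fin δ) (Fin δ) R)
    (p : MvPolynomial (Fin n) ℂ) : Matrix (Fin δ) (Fin δ) R :=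
  ∑ d ∈ Finset.range δ, ∑ γ ∈ (Finset.univ : Finset (Fin n)).finsuppAntidiag d,
    ((multiFactorial γ : ℂ)⁻¹ • aeval z (iterPderiv γ p)) • multiPow M γ

variable {z : Fin n → R} {M : Fin n → Matrix (Fin δ) (Fin δ) R}

omit [Algebra ℂ R] in
theorem multiPow_eq_zero (hM : ∀ i, IsLowerBy 1 (M i)) {γ : Fin n →₀ ℕ}
    (h : δ ≤ ∑ i, γ i) : multiPow M γ = 0 :=
  (IsLowerBy.multiPow hM γ).eq_zero h

omit [Algebra ℂ R] in
theorem support_smul_multiPow_subset (hM : ∀ i, IsLowerBy 1 (M i)) (c : (Fin n →₀ ℕ) → R) :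
    (Function.support fun γ : Fin n →₀ ℕ => c γ • multiPow M γ) ⊆
      ↑((Finset.range δ).biUnion fun d => (Finset.univ : Finset (Fin n)).finsuppAntidiag d) := by
  intro γ hγ
  simp only [Finset.coe_biUnion, Set.mem_iUnion, Finset.mem_coe, Finset.mem_range,
    Finset.mem_finsuppAntidiag]
  refine ⟨_, ?_, rfl, Finset.subset_univ _⟩
  by_contra h
  exact hγ (by simp [multiPow_eq_zero hM (not_lt.1 h)])

/-- Without the truncation, the shift `γ ↦ γ + e_i` of the summation index has no boundary terms. -/
theorem taylorMatrix_eq_finsum (hM : ∀ i, IsLowerBy 1 (M i)) (p : MvPolynomial (Fin n) ℂ) :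
    taylorMatrix z M p = ∑ᶠ γ : Fin n →₀ ℕ,
      ((multiFactorial γ : ℂ)⁻¹ • aeval z (iterPderiv γ p)) • multiPow M γ := by
  rw [finsum_eq_sum_of_support_subset _ (support_smul_multiPow_subset hM _),
    Finset.sum_biUnion, taylorMatrix]
  intro a _ b _ hab
  refine Finset.disjoint_left.2 fun γ ha hb => hab ?_
  rw [Finset.mem_finsuppAntidiag] at ha hb
  exact ha.1.symm.trans hb.1

theorem taylorMatrix_add (p q : MvPolynomial (Fin n) ℂ) :
    taylorMatrix z M (p + q) = taylorMatrix z M p + taylorMatrix z M q := by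
  simp only [taylorMatrix, map_add, smul_add, add_smul, Finset.sum_add_distrib]

theorem taylorMatrix_smul (c : ℂ) (p : MvPolynomial (Fin n) ℂ) :
    taylorMatrix z M (c • p) = c • taylorMatrix z M p := by
  simp only [taylorMatrix, map_smul, Finset.smul_sum]
  refine Finset.sum_congr rfl fun d _ => Finset.sum_congr rfl fun γ _ => ?_
  rw [smul_comm, smul_assoc]

theorem taylorMatrix_one (hM : ∀ i, IsLowerBy 1 (M i)) : taylorMatrix z M 1 = 1 := by
  rw [taylorMatrix_eq_finsum hM, finsum_eq_single _ 0]
  · simp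
  · intro γ hγ
    simp [iterPderiv_one γ hγ]

/-- The Leibniz rule splits the sum into `z i` times the old one and a sum with weights `γ_i / γ!`.
Substituting `γ = β + e_i` turns these into `1 / β!` and releases one factor `M i`. -/
theorem taylorMatrix_X_mul (hM : ∀ i, IsLowerBy 1 (M i)) (hc : ∀ i j, Commute (M i) (M j))
    (i : Fin n) (p : MvPolynomial (Fin n) ℂ) :
    taylorMatrix z M (X i * p) = (z i • 1 + M i) * taylorMatrix z M p := by
  have hfin : ∀ c : (Fin n →₀ ℕ) → R,
      (Function.support fun γ : Fin n →₀ ℕ => c γ • multiPow M γ).Finite := fun c =>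
    (Finset.finite_toSet _).subset (support_smul_multiPow_subset hM c)
  have hshift : (∑ᶠ γ : Fin n →₀ ℕ, ((multiFactorial γ : ℂ)⁻¹ •
      aeval z (γ i • iterPderiv (γ - Finsupp.single i 1) p)) • multiPow M γ) =
      ∑ᶠ β : Fin n →₀ ℕ, M i * (((multiFactorial β : ℂ)⁻¹ • aeval z (iterPderiv β p)) •
        multiPow M β) := by
    have hinj : Function.Injective fun β : Fin n →₀ ℕ => β + Finsupp.single i 1 :=
      fun a b h => add_right_cancel h
    rw [← finsum_mem_univ, ← finsum_mem_inter_support_eq' _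
      (Set.range fun β : Fin n →₀ ℕ => β + Finsupp.single i 1) Set.univ, finsum_mem_range hinj]
    · refine finsum_congr fun β => ?_
      rw [multiPow_add_single hc, add_tsub_cancel_right, multiFactorial_add_single,
        Matrix.mul_smul, ← Nat.cast_smul_eq_nsmul ℂ, map_smul, smul_smul]
      congr 2
      have h1 : (β i : ℂ) + 1 ≠ 0 := Nat.cast_add_one_ne_zero _
      have h2 : (multiFactorial β : ℂ) ≠ 0 := Nat.cast_ne_zero.2 (multiFactorial_ne_zero β)
      simp
      field_simp
    -- Exponents that are not of the form `β + e_i` have `γ i = 0` and contribute nothing.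
    · intro γ hγ
      simp only [Set.mem_univ, iff_true]
      refine ⟨γ - Finsupp.single i 1, tsub_add_cancel_of_le ?_⟩
      have : γ i ≠ 0 := by
        intro h0
        exact hγ (by simp [h0])
      simpa [Nat.one_le_iff_ne_zero] using this
  rw [add_mul, taylorMatrix_eq_finsum hM, taylorMatrix_eq_finsum hM p, Matrix.smul_mul, one_mul,
    smul_finsum' _ (hfin _), mul_finsum' _ _ (hfin _), ← hshift,
    ← finsum_add_distrib]
  · refine finsum_congr fun γ => ?_
    rw [iterPderiv_X_mul, map_add, smul_add, add_smul, map_mul, aeval_X, smul_smul, mul_smul_comm]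
  · refine (hfin fun γ => z i * ((multiFactorial γ : ℂ)⁻¹ • aeval z (iterPderiv γ p))).subset ?_
    intro γ hγ
    simpa only [mul_smul] using hγ
  · exact hfin _

theorem taylorMatrix_mul (hM : ∀ i, IsLowerBy 1 (M i)) (hc : ∀ i j, Commute (M i) (M j))
    (p q : MvPolynomial (Fin n) ℂ) :
    taylorMatrix z M (p * q) = taylorMatrix z M p * taylorMatrix z M q := by
  induction p using MvPolynomial.induction_on generalizing q with
  | C a =>
    rw [← smul_eq_C_mul, taylorMatrix_smul, ← mul_one (C a), ← smul_eq_C_mul, taylorMatrix_smul,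
      taylorMatrix_one hM, Matrix.smul_mul, one_mul]
  | add p p' hp hp' => rw [add_mul, taylorMatrix_add, hp, hp', taylorMatrix_add, add_mul]
  | mul_X p i hp =>
    rw [mul_assoc, hp, taylorMatrix_X_mul hM hc, hp, ← mul_one (X i), taylorMatrix_X_mul hM hc,
      taylorMatrix_one hM, mul_one, mul_assoc]

/-- The nilpotent part `M` only contributes below the diagonal, so `p(z + M)` is invertible as soon
as `p(z)` is a unit. -/
theorem taylorMatrix_lower (hM : ∀ i, IsLowerBy 1 (M i)) (hc : ∀ i j, Commute (M i) (M j))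
    (p : MvPolynomial (Fin n) ℂ) :
    IsLowerBy 0 (taylorMatrix z M p) ∧ ∀ j, taylorMatrix z M p j j = aeval z p := by
  induction p using MvPolynomial.induction_on with
  | C a =>
    rw [← mul_one (C a), ← smul_eq_C_mul, taylorMatrix_smul, taylorMatrix_one hM]
    refine ⟨fun j k h => ?_, fun j => ?_⟩
    · rw [Matrix.smul_apply, IsLowerBy.one j k h, smul_zero]
    · simp
  | add p p' hp hp' =>
    rw [taylorMatrix_add]
    exact ⟨fun j k h => by rw [Matrix.add_apply, hp.1 j k h, hp'.1 j k h, add_zero],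
      fun j => by rw [Matrix.add_apply, hp.2, hp'.2, map_add]⟩
  | mul_X p i hp =>
    have hz : IsLowerBy 0 (M i * taylorMatrix z M p) ∧
        ∀ j, (M i * taylorMatrix z M p) j j = 0 :=
      ⟨fun j k h => ((hM i).mul hp.1) j k (by omega), fun j => ((hM i).mul hp.1) j j (by omega)⟩
    rw [mul_comm, taylorMatrix_X_mul hM hc, add_mul, Matrix.smul_mul, one_mul]
    exact ⟨fun j k h => by
        rw [Matrix.add_apply, Matrix.smul_apply, hp.1 j k h, hz.1 j k h, smul_zero, add_zero],
      fun j => by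
        rw [Matrix.add_apply, Matrix.smul_apply, hp.2, hz.2, add_zero, map_mul, aeval_X,
          smul_eq_mul]⟩

theorem isUnit_det_taylorMatrix (hM : ∀ i, IsLowerBy 1 (M i))
    (hc : ∀ i j, Commute (M i) (M j)) {p : MvPolynomial (Fin n) ℂ} (hp : IsUnit (aeval z p)) :
    IsUnit (taylorMatrix z M p).det := by
  obtain ⟨h1, h2⟩ := taylorMatrix_lower (z := z) hM hc p
  rw [Matrix.det_of_isLowerTriangular _ fun j k h => h1 j k (by simpa using h)]
  simpa only [h2, Finset.prod_const] using hp.pow _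

variable [NeZero δ]

/-- A linear map that satisfies the recursion of the normal form is the first column of the
Taylor matrix. -/
theorem eq_taylorMatrix_col (hM : ∀ i, IsLowerBy 1 (M i)) (hc : ∀ i j, Commute (M i) (M j))
    (φ : MvPolynomial (Fin n) ℂ →ₗ[ℂ] Fin δ → R) (h1 : φ 1 = Pi.single 0 1)
    (hX : ∀ i p, φ (X i * p) = z i • φ p + (M i).mulVec (φ p)) (p : MvPolynomial (Fin n) ℂ) :
    φ p = (taylorMatrix z M p).col 0 := by
  induction p using MvPolynomial.induction_on with
  | C a =>
    rw [← mul_one (C a), ← smul_eq_C_mul, map_smul, taylorMatrix_smul, taylorMatrix_one hM, h1]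
    funext j
    simp [Matrix.one_apply, Pi.single_apply]
  | add p p' hp hp' => rw [map_add, hp, hp', taylorMatrix_add]; rfl
  | mul_X p i hp =>
    rw [mul_comm, hX, hp, taylorMatrix_X_mul hM hc, add_mul, Matrix.smul_mul, one_mul]
    rfl

/-- If the normal forms of the elements of `F` vanish, then so do the normal forms of the elements
of the primary component of `F` at any point where the base point `z` specializes to. -/
theorem taylorMatrix_col_eq_zero_of_mem (hM : ∀ i, IsLowerBy 1 (M i))
    (hc : ∀ i j, Commute (M i) (M j)) {ι : Type*} {F : ι → MvPolynomial (Fin n) ℂ}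
    (hF : ∀ k, (taylorMatrix z M (F k)).col 0 = 0) {ξ : Fin n → ℂ}
    (hz : ∀ p, eval ξ p ≠ 0 → IsUnit (aeval z p)) {q : MvPolynomial (Fin n) ℂ}
    (hq : q ∈ primaryComponent (Ideal.span (Set.range F)) ξ) :
    (taylorMatrix z M q).col 0 = 0 := by
  have hcol : ∀ p q : MvPolynomial (Fin n) ℂ, (taylorMatrix z M (p * q)).col 0 =
      (taylorMatrix z M p).mulVec ((taylorMatrix z M q).col 0) := by
    intro p q
    rw [taylorMatrix_mul hM hc]
    rfl
  have hI : ∀ q ∈ Ideal.span (Set.range F), (taylorMatrix z M q).col 0 = 0 := by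
    intro q hq
    induction hq using Submodule.span_induction with
    | mem q hq => obtain ⟨k, rfl⟩ := hq; exact hF k
    | zero => 
      have := taylorMatrix_smul (z := z) (M := M) 0 0
      rw [zero_smul, zero_smul] at this
      rw [this]; rfl
    | add a b _ _ ha hb =>
      rw [taylorMatrix_add]
      exact (congrArg₂ (· + ·) ha hb).trans (add_zero 0)
    | smul c a _ ha => rw [smul_eq_mul, hcol, ha, Matrix.mulVec_zero]
  -- Passing from the ideal to its primary component: `p * q` lies in the ideal, and the Taylor
  -- matrix of `p` can be cancelled because its determinant is a unit.
  obtain ⟨p, hp, hpq⟩ := hq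
  have h := hI _ hpq
  rw [hcol] at h
  have hu := isUnit_det_taylorMatrix hM hc (hz p hp)
  calc (taylorMatrix z M q).col 0
      = ((taylorMatrix z M p)⁻¹ * taylorMatrix z M p).mulVec ((taylorMatrix z M q).col 0) := by
        rw [Matrix.nonsing_inv_mul _ hu, Matrix.one_mulVec]
    _ = 0 := by rw [← Matrix.mulVec_mulVec, h, Matrix.mulVec_zero]

end NormalForm

/-! ### Differential functionals and their symbols. -/

section DifferentialFunctionals

variable {n : ℕ}

theorem diffFunctional_monomial (ξ : Fin n → ℂ) (β : Fin n →₀ ℕ) (c : ℂ)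
    (p : MvPolynomial (Fin n) ℂ) :
    diffFunctional ξ (monomial β c) p = c * eval ξ (iterPderiv β p) := by
  have h : (monomial β c : MvPolynomial (Fin n) ℂ) = c • basisMonomials (Fin n) ℂ β := by
    simp [smul_monomial]
  rw [h, map_smul, diffFunctional, Module.Basis.constr_basis]
  simp [aeval_eq_eval]

/-- The commutator of `∂^β` with `x_i - ξ_i` is the formal derivative of the symbol, and the
remaining term vanishes at `ξ`. -/
theorem diffFunctional_pderiv (ξ : Fin n → ℂ) (i : Fin n) (L p : MvPolynomial (Fin n) ℂ) :
    diffFunctional ξ (pderiv i L) p = diffFunctional ξ L ((X i - C (ξ i)) * p) := by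
  induction L using MvPolynomial.induction_on' with
  | monomial β c =>
    rw [pderiv_monomial, diffFunctional_monomial, diffFunctional_monomial, sub_mul, map_sub,
      iterPderiv_X_mul, ← smul_eq_C_mul, map_smul]
    simp
    ring
  | add p q hp hq => rw [map_add, map_add, map_add, LinearMap.add_apply, LinearMap.add_apply, hp, hq]

@[simp] theorem shiftedMonomial_zero (ξ : Fin n → ℂ) : shiftedMonomial ξ 0 = 1 := by
  simp [shiftedMonomial]

theorem shiftedMonomial_add_single (ξ : Fin n → ℂ) (β : Fin n →₀ ℕ) (i : Fin n) :
    shiftedMonomial ξ (β + Finsupp.single i 1) = (X i - C (ξ i)) * shiftedMonomial ξ β := by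
  simp only [shiftedMonomial, Finsupp.add_apply, pow_add, Finset.prod_mul_distrib]
  rw [mul_comm]
  congr 1
  rw [Finset.prod_eq_single i]
  · simp
  · intro k _ hk; simp [hk.symm]
  · simp

/-- Each factor `x_i - ξ_i` moves to the symbol as a derivative, until only the constant coefficient
of `∂^β L` is left. -/
theorem diffFunctional_shiftedMonomial (ξ : Fin n → ℂ) (β : Fin n →₀ ℕ)
    (L : MvPolynomial (Fin n) ℂ) :
    diffFunctional ξ L (shiftedMonomial ξ β) = multiFactorial β * coeff β L := by
  induction β using exponent_induction generalizing L with
  | h0 =>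
    rw [shiftedMonomial_zero]
    induction L using MvPolynomial.induction_on' with
    | monomial β c =>
      rw [diffFunctional_monomial]
      by_cases h : β = 0
      · subst h; simp
      · simp [iterPderiv_one β h, coeff_monomial, h]
    | add p q hp hq => rw [map_add, LinearMap.add_apply, hp, hq, coeff_add]; ring
  | hs β i ih =>
    rw [shiftedMonomial_add_single, ← diffFunctional_pderiv, ih, multiFactorial_add_single]
    have : coeff β (pderiv i L) = (β i + 1) * coeff (β + Finsupp.single i 1) L := by
      induction L using MvPolynomial.induction_on' with
      | monomial γ c =>
        rw [pderiv_monomial, coeff_monomial, coeff_monomial]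
        by_cases h : γ = β + Finsupp.single i 1
        · subst h; simp; ring
        · rw [if_neg h, mul_zero]
          split_ifs with h'
          · have : γ i = 0 := by
              by_contra h0
              apply h
              rw [← h', tsub_add_cancel_of_le]
              simpa [Nat.one_le_iff_ne_zero] using h0
            simp [this]
          · rfl
      | add p q hp hq => rw [map_add, coeff_add, coeff_add, hp, hq]; ring
    rw [this]
    push_cast
    ring

/-- The strict drop in order is the source of strict triangularity of the multiplication matrices.
-/
theorem totalDegree_pderiv_lt {σ R : Type*} [CommRing R] (i : σ) {L : MvPolynomial σ R}
    (h : pderiv i L ≠ 0) : (pderiv i L).totalDegree < L.totalDegree := by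
  have hL : L = ∑ s ∈ L.support, monomial s (coeff s L) := L.as_sum
  have hd : pderiv i L = ∑ s ∈ L.support,
      monomial (s - Finsupp.single i 1) (coeff s L * s i) := by
    conv_lhs => rw [hL, map_sum]
    simp only [pderiv_monomial]
  have hpos : 0 < L.totalDegree := by
    rw [pos_iff_ne_zero]
    intro h0
    rw [totalDegree_eq_zero_iff_eq_C.1 h0, pderiv_C] at h
    exact h rfl
  have hle : (pderiv i L).totalDegree ≤ L.totalDegree - 1 := by
    rw [hd]
    refine totalDegree_finsetSum_le fun s hs => ?_
    by_cases h0 : s i = 0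
    · simp [h0]
    · refine (totalDegree_monomial_le _ _).trans ?_
      change (s - Finsupp.single i 1).degree ≤ _
      have h1 : s.degree ≤ L.totalDegree := le_totalDegree hs
      have h2 : s - Finsupp.single i 1 + Finsupp.single i 1 = s :=
        tsub_add_cancel_of_le (by simpa [Nat.one_le_iff_ne_zero] using h0)
      have h3 : (s - Finsupp.single i 1).degree + 1 = s.degree := by
        conv_rhs => rw [← h2, map_add, Finsupp.degree_single]
      omega
  omega

end DifferentialFunctionals

/-! ### The inverse system, the dual basis and the multiplication matrices. -/

section DualBasis

variable {n δ : ℕ} [NeZero δ] {ι : Type*} {F : ι → MvPolynomial (Fin n) ℂ} {ξ : Fin n → ℂ}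
  {α : Fin δ → Fin n →₀ ℕ} {Λ : Fin δ → MvPolynomial (Fin n) ℂ}

theorem mem_inverseSystem_iff {L : MvPolynomial (Fin n) ℂ} :
    L ∈ inverseSystem F ξ ↔ ∀ p ∈ Ideal.span (Set.range F), diffFunctional ξ L p = 0 := by
  simp [inverseSystem, Submodule.mem_dualAnnihilator]

/-- By duality this says that the ideal is stable under multiplication by `x_i - ξ_i`. -/
theorem pderiv_mem_inverseSystem (i : Fin n) {L : MvPolynomial (Fin n) ℂ}
    (hL : L ∈ inverseSystem F ξ) : pderiv i L ∈ inverseSystem F ξ := by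
  rw [mem_inverseSystem_iff] at hL ⊢
  intro p hp
  rw [diffFunctional_pderiv]
  exact hL _ (Ideal.mul_mem_left _ _ hp)

omit [NeZero δ] in
theorem dualCoeff_eq (Λ : Fin δ → MvPolynomial (Fin n) ℂ) (ξ : Fin n → ℂ) (j : Fin δ)
    (β : Fin n →₀ ℕ) : dualCoeff Λ j β = diffFunctional ξ (Λ j) (shiftedMonomial ξ β) :=
  (diffFunctional_shiftedMonomial ξ β (Λ j)).symm

namespace IsPrimalDualPair

variable (hB : IsPrimalDualPair F ξ α Λ)
include hB

/-- The filtration property puts `L` in the span of the `Λ k`; orthogonality reads off the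
coefficients. -/
theorem expand {L : MvPolynomial (Fin n) ℂ} (hL : L ∈ inverseSystem F ξ) :
    L = ∑ k, diffFunctional ξ L (shiftedMonomial ξ (α k)) • Λ k := by
  have hmem : L ∈ Submodule.span ℂ {L' | ∃ j, Λ j = L' ∧ (Λ j).totalDegree ≤ L.totalDegree} := by
    rw [← hB.filtration]
    exact ⟨hL, by simp [mem_restrictTotalDegree]⟩
  generalize L.totalDegree = t at hmem
  clear hL
  induction hmem using Submodule.span_induction with
  | mem L h =>
    obtain ⟨j, rfl, -⟩ := h
    simp [hB.orthogonal]
  | zero => simp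
  | add a b _ _ ha hb =>
    conv_lhs => rw [ha, hb]
    simp [add_smul, Finset.sum_add_distrib]
  | smul c a _ ha =>
    conv_lhs => rw [ha]
    simp [mul_smul, Finset.smul_sum]

theorem totalDegree_le_of_ne_zero {L : MvPolynomial (Fin n) ℂ} (hL : L ∈ inverseSystem F ξ)
    {k : Fin δ} (hk : diffFunctional ξ L (shiftedMonomial ξ (α k)) ≠ 0) :
    (Λ k).totalDegree ≤ L.totalDegree := by
  have hmem : L ∈ Submodule.span ℂ {L' | ∃ j, Λ j = L' ∧ (Λ j).totalDegree ≤ L.totalDegree} := by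
    rw [← hB.filtration]
    exact ⟨hL, by simp [mem_restrictTotalDegree]⟩
  by_contra hlt
  apply hk
  generalize L.totalDegree = t at hmem hlt
  clear hL hk
  induction hmem using Submodule.span_induction with
  | mem L h =>
    obtain ⟨j, rfl, h⟩ := h
    rw [hB.orthogonal, if_neg]
    rintro rfl
    exact hlt h
  | zero => simp
  | add a b _ _ ha hb => rw [map_add, LinearMap.add_apply, ha, hb, add_zero]
  | smul c a _ ha => rw [map_smul, LinearMap.smul_apply, ha, smul_zero]

theorem exponent_injective : Function.Injective α := by
  intro j k h
  have h1 := hB.orthogonal j k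
  rw [← h, hB.orthogonal j j] at h1
  by_contra hne
  simp [hne] at h1

end IsPrimalDualPair

/-- The matrix of multiplication by `x_i - ξ_i` on the local ring, in the primal basis. -/
def multMatrix (α : Fin δ → Fin n →₀ ℕ) (Λ : Fin δ → MvPolynomial (Fin n) ℂ) (i : Fin n) :
    Matrix (Fin δ) (Fin δ) ℂ :=
  Matrix.of fun j k => dualCoeff Λ j (α k + Finsupp.single i 1)

/-- The vector of the values `Λ_j(p)`, which is the normal form of `p`. -/
def dualValues (ξ : Fin n → ℂ) (Λ : Fin δ → MvPolynomial (Fin n) ℂ) :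
    MvPolynomial (Fin n) ℂ →ₗ[ℂ] Fin δ → ℂ :=
  LinearMap.pi fun j => diffFunctional ξ (Λ j)

omit [NeZero δ] in
theorem multMatrix_apply (ξ : Fin n → ℂ) (i : Fin n) (j k : Fin δ) : multMatrix α Λ i j k =
    diffFunctional ξ (pderiv i (Λ j)) (shiftedMonomial ξ (α k)) := by
  rw [multMatrix, Matrix.of_apply, dualCoeff, ← diffFunctional_shiftedMonomial ξ,
    shiftedMonomial_add_single, diffFunctional_pderiv]

namespace IsPrimalDualPair

variable (hB : IsPrimalDualPair F ξ α Λ)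
include hB

theorem pderiv_dual (i : Fin n) (j : Fin δ) :
    pderiv i (Λ j) = ∑ k, multMatrix α Λ i j k • Λ k := by
  simp only [multMatrix_apply ξ]
  exact hB.expand (pderiv_mem_inverseSystem i (hB.mem_inverseSystem j))

/-- A nonzero entry `(j, k)` forces `ord Λ_k ≤ ord (∂_i Λ_j) < ord Λ_j`, and the orders are
nondecreasing, so `k < j`. -/
theorem multMatrix_lower (i : Fin n) : IsLowerBy 1 (multMatrix α Λ i) := by
  intro j k hjk
  by_contra h
  rw [multMatrix_apply ξ] at h
  have h1 := hB.totalDegree_le_of_ne_zero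
    (pderiv_mem_inverseSystem i (hB.mem_inverseSystem j)) h
  have h2 : pderiv i (Λ j) ≠ 0 := by
    intro h0
    simp [h0] at h
  have h3 := totalDegree_pderiv_lt i h2
  have h4 : (Λ j).totalDegree ≤ (Λ k).totalDegree :=
    hB.ord_mono (Fin.le_def.2 (by omega))
  omega

theorem multMatrix_of_eq {i : Fin n} {k l : Fin δ} (h : α l = α k + Finsupp.single i 1)
    (j : Fin δ) : multMatrix α Λ i j k = if j = l then 1 else 0 := by
  rw [multMatrix, Matrix.of_apply, ← h, dualCoeff_eq Λ ξ, hB.orthogonal]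

theorem multMatrix_mul_apply (a b : Fin n) (j l : Fin δ) :
    (multMatrix α Λ b * multMatrix α Λ a) j l =
      diffFunctional ξ (pderiv a (pderiv b (Λ j))) (shiftedMonomial ξ (α l)) := by
  rw [hB.pderiv_dual b j, Matrix.mul_apply]
  simp [multMatrix_apply ξ a]

/-- Products of these matrices record second derivatives of the symbols, which are symmetric. -/
theorem multMatrix_commute (a b : Fin n) : Commute (multMatrix α Λ a) (multMatrix α Λ b) := by
  ext j l
  rw [hB.multMatrix_mul_apply, hB.multMatrix_mul_apply, pderiv_comm]

theorem dualValues_shiftedMonomial (k : Fin δ) :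
    dualValues ξ Λ (shiftedMonomial ξ (α k)) = Pi.single k 1 := by
  funext j
  simp [dualValues, hB.orthogonal, Pi.single_apply]

theorem dualValues_one : dualValues ξ Λ 1 = Pi.single 0 1 := by
  rw [← hB.dualValues_shiftedMonomial, hB.exponent_zero, shiftedMonomial_zero]

theorem dualValues_shift_mul (i : Fin n) (p : MvPolynomial (Fin n) ℂ) :
    dualValues ξ Λ ((X i - C (ξ i)) * p) = (multMatrix α Λ i).mulVec (dualValues ξ Λ p) := by
  funext j
  simp only [dualValues, LinearMap.pi_apply, ← diffFunctional_pderiv]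
  rw [hB.pderiv_dual i j]
  simp [Matrix.mulVec, dotProduct]

theorem dualValues_X_mul (i : Fin n) (p : MvPolynomial (Fin n) ℂ) :
    dualValues ξ Λ (X i * p) =
      ξ i • dualValues ξ Λ p + (multMatrix α Λ i).mulVec (dualValues ξ Λ p) := by
  rw [← hB.dualValues_shift_mul, sub_mul, map_sub, ← smul_eq_C_mul, map_smul]
  abel

theorem dualValues_eq_taylorMatrix (p : MvPolynomial (Fin n) ℂ) :
    dualValues ξ Λ p = (taylorMatrix ξ (multMatrix α Λ) p).col 0 :=
  eq_taylorMatrix_col hB.multMatrix_lower hB.multMatrix_commute _ hB.dualValues_one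
    hB.dualValues_X_mul p

theorem multiPow_col (γ : Fin n →₀ ℕ) :
    (multiPow (multMatrix α Λ) γ).col 0 = dualValues ξ Λ (shiftedMonomial ξ γ) := by
  induction γ using exponent_induction with
  | h0 =>
    rw [shiftedMonomial_zero, hB.dualValues_one]
    funext j
    simp [Matrix.one_apply, Pi.single_apply]
  | hs γ i ih =>
    rw [multiPow_add_single hB.multMatrix_commute, shiftedMonomial_add_single,
      hB.dualValues_shift_mul, ← ih]
    rfl

theorem multiPow_apply_zero (j : Fin δ) (γ : Fin n →₀ ℕ) :
    multiPow (multMatrix α Λ) γ j 0 = dualCoeff Λ j γ := by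
  rw [dualCoeff_eq Λ ξ]
  exact congrFun (hB.multiPow_col γ) j

theorem dualValues_eq_zero_of_mem_span {p : MvPolynomial (Fin n) ℂ}
    (hp : p ∈ Ideal.span (Set.range F)) : dualValues ξ Λ p = 0 := by
  funext j
  exact mem_inverseSystem_iff.1 (hB.mem_inverseSystem j) p hp

/-- By definition the `Λ j` annihilate only `I`; writing their values as a Taylor matrix column
extends this to `Q`. -/
theorem dualValues_eq_zero_of_mem {q : MvPolynomial (Fin n) ℂ}
    (hq : q ∈ primaryComponent (Ideal.span (Set.range F)) ξ) : dualValues ξ Λ q = 0 := by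
  rw [hB.dualValues_eq_taylorMatrix]
  refine taylorMatrix_col_eq_zero_of_mem hB.multMatrix_lower hB.multMatrix_commute
    (F := F) (fun k => ?_) (fun p hp => ?_) hq
  · rw [← hB.dualValues_eq_taylorMatrix]
    exact hB.dualValues_eq_zero_of_mem_span (Ideal.subset_span ⟨k, rfl⟩)
  · rw [aeval_eq_eval]
    exact hp.isUnit

/-- Every polynomial agrees with its normal form modulo the primary component. -/
theorem sub_normalForm_mem (p : MvPolynomial (Fin n) ℂ) :
    p - ∑ k, dualValues ξ Λ p k • shiftedMonomial ξ (α k) ∈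
      primaryComponent (Ideal.span (Set.range F)) ξ := by
  have h : Ideal.Quotient.mk (primaryComponent (Ideal.span (Set.range F)) ξ) p ∈
      Submodule.span ℂ (Set.range fun k =>
        Ideal.Quotient.mk (primaryComponent (Ideal.span (Set.range F)) ξ)
          (shiftedMonomial ξ (α k))) := by
    rw [hB.span_eq_top]; trivial
  obtain ⟨c, hc⟩ := (Submodule.mem_span_range_iff_exists_fun ℂ).1 h
  have hmem : p - ∑ k, c k • shiftedMonomial ξ (α k) ∈
      primaryComponent (Ideal.span (Set.range F)) ξ := by
    rw [← Ideal.Quotient.eq, ← hc, ← Ideal.Quotient.mkₐ_eq_mk ℂ]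
    simp only [map_sum, map_smul]
  have hval := hB.dualValues_eq_zero_of_mem hmem
  -- The dual basis vanishes on the difference, so orthogonality identifies the coordinates in the
  -- primal basis.
  have hck : dualValues ξ Λ p = c := by
    rw [map_sub, sub_eq_zero] at hval
    rw [hval]
    funext j
    simp [hB.dualValues_shiftedMonomial, Pi.single_apply]
  rwa [hck]

end IsPrimalDualPair

end DualBasis

/-! ### Simple roots and invertible Jacobians. -/

section SimpleRoots

variable {σ : Type*} [Fintype σ]

/-- Hadamard's lemma for polynomials. -/
theorem exists_hadamard (x : σ → ℂ) (p : MvPolynomial σ ℂ) :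
    ∃ h : σ → MvPolynomial σ ℂ, p = C (eval x p) + ∑ b, h b * (X b - C (x b)) ∧
      ∀ b, eval x (h b) = eval x (pderiv b p) := by
  classical
  have key : ∃ h : σ → MvPolynomial σ ℂ, p = C (eval x p) + ∑ b, h b * (X b - C (x b)) := by
    induction p using MvPolynomial.induction_on with
    | C a => exact ⟨0, by simp⟩
    | add p q hp hq =>
      obtain ⟨h, hp⟩ := hp
      obtain ⟨g, hq⟩ := hq
      refine ⟨h + g, ?_⟩
      conv_lhs => rw [hp, hq]
      simp only [Pi.add_apply, add_mul, Finset.sum_add_distrib, map_add]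
      ring
    | mul_X p i hp =>
      obtain ⟨h, hp⟩ := hp
      -- From `p X_i = (p - p(x)) X_i + p(x) (X_i - x_i) + p(x) x_i`.
      refine ⟨fun b => h b * X i + Pi.single (M := fun _ => MvPolynomial σ ℂ) i (C (eval x p)) b, ?_⟩
      have h1 : ∑ b, Pi.single (M := fun _ => MvPolynomial σ ℂ) i (C (eval x p)) b *
           (X b - C (x b)) =
          C (eval x p) * (X i - C (x i)) := by
        rw [Finset.sum_eq_single i]
        · simp
        · intro b _ hb; simp [hb]
        · simp
      simp only [add_mul, Finset.sum_add_distrib, h1]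
      conv_lhs => rw [hp, add_mul, Finset.sum_mul]
      rw [map_mul, eval_X, map_mul]
      have : ∀ b, h b * X i * (X b - C (x b)) = h b * (X b - C (x b)) * X i := fun b => by ring
      simp only [this]
      ring
  obtain ⟨h, hp⟩ := key
  refine ⟨h, hp, fun b => ?_⟩
  conv_rhs => rw [hp]
  simp [pderiv_X, Pi.single_apply, Finset.sum_add_distrib]

/-- A square system vanishing at `x` factors through `X - x` by a matrix extending its Jacobian. -/
theorem exists_hadamard_matrix (G : σ → MvPolynomial σ ℂ) {x : σ → ℂ}
    (hG : ∀ a, eval x (G a) = 0) : ∃ H : Matrix σ σ (MvPolynomial σ ℂ),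
      (∀ a, G a = ∑ b, H a b * (X b - C (x b))) ∧ H.map (eval x) = jacobianAt G x := by
  choose h h1 h2 using fun a => exists_hadamard x (G a)
  refine ⟨Matrix.of h, fun a => ?_, ?_⟩
  · conv_lhs => rw [h1 a, hG a, map_zero, zero_add]
    rfl
  · ext a b
    exact h2 a b

variable [DecidableEq σ]

/-- Cramer's rule for `G = H (X - x)`. When `det H` is nonzero at `x`, it isolates the root and puts
every `X b - C (x b)` in the primary component. -/
theorem det_mul_X_sub_C {G : σ → MvPolynomial σ ℂ} {x : σ → ℂ}
    {H : Matrix σ σ (MvPolynomial σ ℂ)} (hH : ∀ a, G a = ∑ b, H a b * (X b - C (x b))) (b : σ) :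
    H.det * (X b - C (x b)) = ∑ a, H.adjugate b a * G a := by
  have h : G = H.mulVec fun b => X b - C (x b) := by
    funext a
    exact hH a
  have h2 : H.adjugate.mulVec G = H.det • fun b => X b - C (x b) := by
    rw [h, Matrix.mulVec_mulVec, Matrix.adjugate_mul, Matrix.smul_mulVec, Matrix.one_mulVec]
  exact (congrFun h2 b).symm

theorem isSimpleRoot_of_det_ne_zero {G : σ → MvPolynomial σ ℂ} {x : σ → ℂ}
    (hG : ∀ a, eval x (G a) = 0) (hJ : (jacobianAt G x).det ≠ 0) : IsSimpleRoot G x := by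
  obtain ⟨H, hH, hHx⟩ := exists_hadamard_matrix G hG
  have hdet : eval x H.det ≠ 0 := by
    rw [RingHom.map_det, RingHom.mapMatrix_apply]
    rwa [hHx]
  refine ⟨⟨hG, ?_⟩, ?_⟩
  · have hev : ∀ᶠ y in 𝓝 x, eval y H.det ≠ 0 :=
      (MvPolynomial.continuous_eval H.det).continuousAt.eventually_ne hdet
    filter_upwards [hev] with y hy hGy
    funext b
    have h := congrArg (eval y) (det_mul_X_sub_C hH b)
    simp only [map_mul, map_sum, hGy, mul_zero, Finset.sum_const_zero, map_sub, eval_X,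
      eval_C, mul_eq_zero, hy, false_or] at h
    exact sub_eq_zero.1 h
  · have hker : primaryComponent (Ideal.span (Set.range G)) x = RingHom.ker (eval x) := by
      apply le_antisymm
      · rintro q ⟨p, hp, hpq⟩
        have hI : Ideal.span (Set.range G) ≤ RingHom.ker (eval x) := by
          rw [Ideal.span_le]
          rintro _ ⟨a, rfl⟩
          exact hG a
        have h := hI hpq
        rw [RingHom.mem_ker, map_mul, mul_eq_zero] at h
        exact h.resolve_left hp
      · intro q hq
        obtain ⟨h, h1, -⟩ := exists_hadamard x q
        rw [RingHom.mem_ker] at hq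
        rw [h1, hq, map_zero, zero_add]
        refine Ideal.sum_mem _ fun b _ => Ideal.mul_mem_left _ _ ⟨H.det, hdet, ?_⟩
        rw [det_mul_X_sub_C hH]
        exact Ideal.sum_mem _ fun a _ => Ideal.mul_mem_left _ _ (Ideal.subset_span ⟨a, rfl⟩)
    have e := Ideal.quotientKerAlgEquivOfSurjective
      (f := (aeval x : MvPolynomial σ ℂ →ₐ[ℂ] ℂ)) (fun c => ⟨C c, by simp⟩)
    have hker' : primaryComponent (Ideal.span (Set.range G)) x =
        RingHom.ker (aeval x : MvPolynomial σ ℂ →ₐ[ℂ] ℂ) := by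
      rw [hker]; ext q; simp [RingHom.mem_ker, aeval_eq_eval]
    rw [multiplicity, hker', e.toLinearEquiv.finrank_eq, Module.finrank_self]

/-- Multiplicity one makes the primary component the maximal ideal of `x`, so `p_b (X_b - x_b) = ∑
g_ba G_a` with `p_b(x) ≠ 0`. Differentiating at `x` gives `g(x) J = diag (p_b(x))`, which is
invertible. -/
theorem det_ne_zero_of_isSimpleRoot {G : σ → MvPolynomial σ ℂ} {x : σ → ℂ}
    (h : IsSimpleRoot G x) : (jacobianAt G x).det ≠ 0 := by
  obtain ⟨⟨hG, -⟩, hm⟩ := h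
  set Q := primaryComponent (Ideal.span (Set.range G)) x with hQ
  have hI : Ideal.span (Set.range G) ≤ RingHom.ker (eval x) := by
    rw [Ideal.span_le]
    rintro _ ⟨a, rfl⟩
    exact hG a
  have hQm : ∀ q ∈ Q, eval x q = 0 := by
    rintro q ⟨p, hp, hpq⟩
    have h := hI hpq
    rw [RingHom.mem_ker, map_mul, mul_eq_zero] at h
    exact h.resolve_left hp
  have hone : Ideal.Quotient.mk Q 1 ≠ 0 := by
    rw [Ne, Ideal.Quotient.eq_zero_iff_mem]
    intro h
    simpa using hQm 1 h
  have hX : ∀ b, X b - C (x b) ∈ Q := by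
    intro b
    -- The quotient is spanned by the class of `1`, so `X b` is congruent to a constant, which
    -- evaluation at `x` shows to be `x b`.
    obtain ⟨c, hc⟩ := (finrank_eq_one_iff_of_nonzero' _ hone).1 hm (Ideal.Quotient.mk Q (X b))
    have h1 : X b - C c ∈ Q := by
      rw [← Ideal.Quotient.eq, ← hc, ← mul_one (C c), ← smul_eq_C_mul]
      rfl
    have h2 : x b = c := by simpa [sub_eq_zero] using hQm _ h1
    rwa [h2]
  choose p hp hpI using hX
  have hcomb : ∀ b, ∃ g : σ → MvPolynomial σ ℂ, ∑ a, g a * G a = p b * (X b - C (x b)) := fun b =>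
    (Ideal.mem_span_range_iff_exists_fun).1 (hpI b)
  choose g hg using hcomb
  have hmul : (Matrix.of fun b a => eval x (g b a)) * jacobianAt G x =
      Matrix.diagonal fun b => eval x (p b) := by
    ext b c
    have h := congrArg (fun q => eval x (pderiv c q)) (hg b)
    simp [hG, pderiv_X, Pi.single_apply] at h
    rw [Matrix.mul_apply, Matrix.diagonal_apply]
    simp only [Matrix.of_apply, jacobianAt]
    rw [h]
    by_cases hbc : b = c
    · simp [hbc]
    · simp [hbc]
  intro h0
  have := congrArg Matrix.det hmul
  rw [Matrix.det_mul, h0, mul_zero, Matrix.det_diagonal] at this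
  exact Finset.prod_ne_zero_iff.2 (fun b _ => hp b) this.symm

end SimpleRoots

/-! ### Quadratic convergence of Newton's method. -/

section Newton

variable {σ : Type*} [Fintype σ] [DecidableEq σ]

omit [Fintype σ] [DecidableEq σ] in
theorem continuous_jacobianAt (G : σ → MvPolynomial σ ℂ) : Continuous (jacobianAt G) :=
  continuous_matrix fun _ _ => MvPolynomial.continuous_eval _

/-- With `G(y) = H(y) (y - x)`, the new error is `J(y)⁻¹ (J(y) - H(y)) (y - x)`; the middle factor
vanishes at `x`, so it is `O(‖y - x‖)`. -/
theorem newtonStep_sub_isBigO {G : σ → MvPolynomial σ ℂ} {x : σ → ℂ}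
    (hG : ∀ a, eval x (G a) = 0) (hJ : (jacobianAt G x).det ≠ 0) :
    (fun y => newtonStep G y - x) =O[𝓝 x] fun y => ‖y - x‖ ^ 2 := by
  obtain ⟨H, hH, hHx⟩ := exists_hadamard_matrix G hG
  have hdet : ∀ᶠ y in 𝓝 x, (jacobianAt G y).det ≠ 0 :=
    ((continuous_jacobianAt G).matrix_det).continuousAt.eventually_ne hJ
  have hform : ∀ᶠ y in 𝓝 x, newtonStep G y - x =
      (jacobianAt G y)⁻¹.mulVec ((jacobianAt G y - H.map (eval y)).mulVec (y - x)) := by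
    filter_upwards [hdet] with y hy
    have hGy : (fun a => eval y (G a)) = (H.map (eval y)).mulVec (y - x) := by
      funext a
      rw [hH a]
      simp [Matrix.mulVec, dotProduct]
    rw [newtonStep, hGy, Matrix.sub_mulVec,
      Matrix.mulVec_sub (jacobianAt G y)⁻¹, Matrix.mulVec_mulVec _ _ (jacobianAt G y),
      Matrix.nonsing_inv_mul _ (isUnit_iff_ne_zero.2 hy), Matrix.one_mulVec]
    abel
  refine Asymptotics.IsBigO.congr' (f₁ := fun y => (jacobianAt G y)⁻¹.mulVec
    ((jacobianAt G y - H.map (eval y)).mulVec (y - x))) ?_ (hform.mono fun y h => h.symm)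
    EventuallyEq.rfl
  have hE : ∀ a b, (fun y => (jacobianAt G y - H.map (eval y)) a b) =O[𝓝 x] fun y => ‖y - x‖ := by
    intro a b
    have hd : DifferentiableAt ℂ (fun y => eval y (pderiv b (G a) - H a b)) x :=
      ((AnalyticOnNhd.eval_mvPolynomial (𝕜 := ℂ) (pderiv b (G a) - H a b)) x
        trivial).differentiableAt
    have h := hd.isBigO_sub.norm_right
    refine h.congr_left fun y => ?_
    have h0 : eval x (H a b) = eval x (pderiv b (G a)) := congrFun (congrFun hHx a) b
    simp [jacobianAt, h0]
  have hinv : ∀ a b, (fun y => (jacobianAt G y)⁻¹ a b) =O[𝓝 x] fun _ => (1 : ℝ) := by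
    intro a b
    have hc : ContinuousAt (fun y => (jacobianAt G y)⁻¹ a b) x := by
      simp only [Matrix.inv_def, Ring.inverse_eq_inv', Matrix.smul_apply]
      exact (((continuous_jacobianAt G).matrix_det).continuousAt.inv₀ hJ).smul
        (((continuous_jacobianAt G).matrix_adjugate.matrix_elem a b).continuousAt)
    exact hc.tendsto.isBigO_one ℝ
  rw [Asymptotics.isBigO_pi]
  intro a
  simp only [Matrix.mulVec, dotProduct]
  refine Asymptotics.IsBigO.fun_sum fun b _ => ?_
  have h2 : (fun y => ∑ c, (jacobianAt G y - H.map (eval y)) b c * (y - x) c) =O[𝓝 x]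
      fun y => ‖y - x‖ ^ 2 := by
    refine Asymptotics.IsBigO.fun_sum fun c _ => ?_
    have h3 : (fun y : σ → ℂ => (y - x) c) =O[𝓝 x] fun y => ‖y - x‖ :=
      Asymptotics.isBigO_of_le _ fun y => by
        simpa using norm_le_pi_norm (y - x) c
    simpa [sq] using (hE b c).mul h3
  simpa using (hinv a b).mul h2

theorem exists_newton_ball {G : σ → MvPolynomial σ ℂ} {x : σ → ℂ} (hx : IsSimpleRoot G x) :
    ∃ r > (0 : ℝ), ∃ c > (0 : ℝ), ∀ y ∈ Metric.ball x r, ∀ m : ℕ,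
      (jacobianAt G ((newtonStep G)^[m] y)).det ≠ 0 ∧
      ‖(newtonStep G)^[m + 1] y - x‖ ≤ c * ‖(newtonStep G)^[m] y - x‖ ^ 2 ∧
      ‖(newtonStep G)^[m] y - x‖ ≤ (1 / 2 : ℝ) ^ (2 ^ m - 1) * ‖y - x‖ := by
  have hJ := det_ne_zero_of_isSimpleRoot hx
  obtain ⟨c, hc, hO⟩ := (newtonStep_sub_isBigO hx.1.1 hJ).exists_pos
  have hdet : ∀ᶠ y in 𝓝 x, (jacobianAt G y).det ≠ 0 :=
    ((continuous_jacobianAt G).matrix_det).continuousAt.eventually_ne hJ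
  obtain ⟨r, hr, hball⟩ := Metric.eventually_nhds_iff.1 (hO.bound.and hdet)
  -- The second bound makes `c * ‖y - x‖ ≤ 1 / 2`.
  refine ⟨min r (1 / (2 * c)), by positivity, c, hc, fun y hy => ?_⟩
  rw [Metric.mem_ball, dist_eq_norm, lt_min_iff] at hy
  have hcy : c * ‖y - x‖ ≤ 1 / 2 := by
    have := hy.2.le
    rw [le_div_iff₀ (by positivity)] at this
    linarith
  have hstep : ∀ w : σ → ℂ, ‖w - x‖ < r →
      (jacobianAt G w).det ≠ 0 ∧ ‖newtonStep G w - x‖ ≤ c * ‖w - x‖ ^ 2 := by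
    intro w hw
    have h := hball (y := w) (by rwa [dist_eq_norm])
    exact ⟨h.2, by simpa using h.1⟩
  have hbound : ∀ m : ℕ, ‖(newtonStep G)^[m] y - x‖ ≤ (1 / 2 : ℝ) ^ (2 ^ m - 1) * ‖y - x‖ ∧
      ‖(newtonStep G)^[m] y - x‖ < r := by
    have hlt : ∀ (k : ℕ) (w : σ → ℂ), ‖w - x‖ ≤ (1 / 2 : ℝ) ^ k * ‖y - x‖ → ‖w - x‖ < r := by
      intro k w hw
      have : (1 / 2 : ℝ) ^ k ≤ 1 := pow_le_one₀ (by norm_num) (by norm_num)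
      nlinarith [norm_nonneg (y - x)]
    intro m
    induction m with
    | zero => simpa using hy.1
    | succ m ih =>
      have hle : ‖(newtonStep G)^[m + 1] y - x‖ ≤
          (1 / 2 : ℝ) ^ (2 ^ (m + 1) - 1) * ‖y - x‖ := by
        rw [Function.iterate_succ_apply']
        refine (hstep _ ih.2).2.trans ?_
        -- Squaring doubles the exponent `2 ^ m - 1`; the missing factor `1 / 2` comes from `c * ‖y
        -- - x‖`.
        have hexp : 2 ^ (m + 1) - 1 = 2 * (2 ^ m - 1) + 1 := by
          have := Nat.one_le_two_pow (n := m)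
          rw [pow_succ]
          omega
        rw [hexp, pow_succ (1 / 2 : ℝ), pow_mul']
        calc c * ‖(newtonStep G)^[m] y - x‖ ^ 2
            ≤ c * ((1 / 2 : ℝ) ^ (2 ^ m - 1) * ‖y - x‖) ^ 2 := by
              gcongr
              exact ih.1
          _ = ((1 / 2 : ℝ) ^ (2 ^ m - 1)) ^ 2 * (c * ‖y - x‖) * ‖y - x‖ := by ring
          _ ≤ ((1 / 2 : ℝ) ^ (2 ^ m - 1)) ^ 2 * (1 / 2) * ‖y - x‖ := by gcongr
      exact ⟨hle, hlt _ _ hle⟩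
  intro m
  refine ⟨(hstep _ (hbound m).2).1, ?_, (hbound m).1⟩
  rw [Function.iterate_succ_apply']
  exact (hstep _ (hbound m).2).2

theorem tendsto_of_quadratic_bound {E : Type*} [SeminormedAddCommGroup E] {u : ℕ → E} {x : E}
    {C : ℝ} (h : ∀ m : ℕ, ‖u m - x‖ ≤ (1 / 2 : ℝ) ^ (2 ^ m - 1) * C) :
    Tendsto u atTop (𝓝 x) := by
  rw [tendsto_iff_norm_sub_tendsto_zero]
  refine squeeze_zero (fun _ => norm_nonneg _) h ?_
  have h1 : Tendsto (fun m : ℕ => 2 ^ m - 1) atTop atTop :=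
    tendsto_atTop_mono (fun m => Nat.le_sub_one_of_lt Nat.lt_two_pow_self) tendsto_id
  have h2 := ((tendsto_pow_atTop_nhds_zero_of_lt_one (r := (1 / 2 : ℝ)) (by norm_num)
    (by norm_num)).comp h1).mul_const C
  simpa using h2

end Newton

/-! ### Square subsystems: selected, generic and random. -/

section Subsystems

variable {σ ε : Type*} [Fintype σ] [DecidableEq σ]

/-- A matrix with trivial kernel has an invertible maximal square submatrix. -/
theorem exists_embedding_det_ne_zero {𝕜 : Type*} [Field 𝕜] (J : Matrix ε σ 𝕜)
    (hJ : ∀ u, J.mulVec u = 0 → u = 0) : ∃ s : σ ↪ ε, (J.submatrix s id).det ≠ 0 := by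
  classical
  have hspan : Submodule.span 𝕜 (Set.range J.row) = ⊤ := by
    -- A nonzero functional vanishing on all rows would be a nonzero kernel vector.
    by_contra hne
    obtain ⟨φ, hφ, hle⟩ := Submodule.exists_le_ker_of_lt_top _ (lt_top_iff_ne_top.2 hne)
    have hval : ∀ w : σ → 𝕜, φ w = ∑ b, w b * φ (Pi.single b 1) := by
      intro w
      conv_lhs => rw [pi_eq_sum_univ' w, map_sum]
      simp [Pi.single]
    apply hφ
    have hu := hJ (fun b => φ (Pi.single b 1)) <| by
      funext e
      have := hle (Submodule.subset_span ⟨e, rfl⟩)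
      rw [LinearMap.mem_ker, hval] at this
      exact this
    refine LinearMap.ext fun w => ?_
    rw [hval]
    simp [fun b => congrFun hu b]
  obtain ⟨κ, a, ha, hsp, hli⟩ := exists_linearIndependent' 𝕜 J.row
  rw [hspan] at hsp
  let bas := Module.Basis.mk hli hsp.ge
  have : Finite κ := hli.finite
  have : Fintype κ := Fintype.ofFinite κ
  have hcard : Fintype.card σ = Fintype.card κ := by
    rw [← Module.finrank_eq_card_basis bas, Module.finrank_fintype_fun_eq_card]
  let e : σ ≃ κ := Fintype.equivOfCardEq hcard
  refine ⟨e.toEmbedding.trans ⟨a, ha⟩, ?_⟩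
  have hrows : LinearIndependent 𝕜 (J.submatrix (a ∘ e) id).row := hli.comp e e.injective
  have hu := Matrix.linearIndependent_rows_iff_isUnit.1 hrows
  exact ((Matrix.isUnit_iff_isUnit_det _).1 hu).ne_zero

variable [Fintype ε]

omit [DecidableEq σ] [Fintype σ] in
theorem jacobianAt_squareSubsystem (P : ε → MvPolynomial σ ℂ) (R : σ → ε → ℂ) (x : σ → ℂ) :
    jacobianAt (squareSubsystem P R) x =
      Matrix.of R * Matrix.of fun e b => eval x (pderiv b (P e)) := by
  ext a b
  simp [jacobianAt, squareSubsystem, Matrix.mul_apply]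

omit [DecidableEq σ] [Fintype σ] in
theorem eval_squareSubsystem {P : ε → MvPolynomial σ ℂ} {x : σ → ℂ} (hP : ∀ e, eval x (P e) = 0)
    (R : σ → ε → ℂ) (a : σ) : eval x (squareSubsystem P R a) = 0 := by
  simp [squareSubsystem, hP]

theorem isSimpleRoot_squareSubsystem {P : ε → MvPolynomial σ ℂ} {x : σ → ℂ}
    (hP : ∀ e, eval x (P e) = 0) {R : σ → ε → ℂ}
    (hR : (Matrix.of R * Matrix.of fun e b => eval x (pderiv b (P e))).det ≠ 0) :
    IsSimpleRoot (squareSubsystem P R) x :=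
  isSimpleRoot_of_det_ne_zero (eval_squareSubsystem hP R) (by rwa [jacobianAt_squareSubsystem])

/-- The determinant of `R J` as a polynomial in the entries of `R`. -/
def genericMinor (J : Matrix ε σ ℂ) : MvPolynomial (σ × ε) ℂ :=
  (Matrix.of fun a b => ∑ e, C (J e b) * X (a, e)).det

theorem eval_genericMinor (J : Matrix ε σ ℂ) (R : σ → ε → ℂ) :
    eval (fun q => R q.1 q.2) (genericMinor J) = (Matrix.of R * J).det := by
  rw [genericMinor, RingHom.map_det]
  congr 1
  ext a b
  simp [Matrix.mul_apply, mul_comm]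

/-- Every matrix entry is a linear form in `R`. -/
theorem totalDegree_genericMinor_le (J : Matrix ε σ ℂ) :
    (genericMinor J).totalDegree ≤ Fintype.card σ := by
  rw [genericMinor, Matrix.det_apply]
  refine totalDegree_finsetSum_le fun τ _ => ?_
  refine (totalDegree_smul_le _ _).trans ((totalDegree_finsetProd _ _).trans ?_)
  rw [← Finset.card_univ, Finset.card_eq_sum_ones]
  refine Finset.sum_le_sum fun a _ => ?_
  rw [Matrix.of_apply]
  refine totalDegree_finsetSum_le fun e _ => ?_
  refine (totalDegree_mul _ _).trans ?_
  simp

omit [Fintype σ] [DecidableEq σ] in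
theorem selection_mul [DecidableEq ε] (s : σ → ε) (J : Matrix ε σ ℂ) :
    (Matrix.of fun a e => if e = s a then (1 : ℂ) else 0) * J = J.submatrix s id := by
  ext a b
  simp [Matrix.mul_apply]

/-- If some `R J` is invertible, then almost every one is. -/
theorem ae_det_mul_ne_zero (J : Matrix ε σ ℂ) (S : σ → ε → ℂ)
    (hS : (Matrix.of S * J).det ≠ 0) :
    ∀ᵐ R : σ → ε → ℂ ∂MeasureTheory.volume, (Matrix.of R * J).det ≠ 0 := by
  have hmeas : MeasurableSet {R : σ → ε → ℂ | (Matrix.of R * J).det ≠ 0} := by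
    refine (isOpen_ne.preimage (f := fun R : σ → ε → ℂ => (Matrix.of R * J).det) ?_).measurableSet
    refine Continuous.matrix_det (Continuous.matrix_mul ?_ continuous_const)
    exact continuous_id
  have hε : (MeasureTheory.volume : MeasureTheory.Measure (ε → ℂ)).IsAddHaarMeasure :=
    inferInstanceAs (MeasureTheory.Measure.pi fun _ : ε =>
      (MeasureTheory.volume : MeasureTheory.Measure ℂ)).IsAddHaarMeasure
  have hσ : (MeasureTheory.volume : MeasureTheory.Measure (σ → ε → ℂ)).IsAddHaarMeasure :=
    MeasureTheory.Measure.pi.isAddHaarMeasure fun _ : σ =>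
      (MeasureTheory.volume : MeasureTheory.Measure (ε → ℂ))
  -- It suffices that each line `R + t S`, with `t` real, meets the exceptional set in a null set.
  refine MeasureTheory.ae_mem_of_ae_add_linearMap_mem
    ((LinearMap.id : ℝ →ₗ[ℝ] ℝ).smulRight S) MeasureTheory.volume MeasureTheory.volume hmeas
    fun R => ?_
  -- Chosen so that `det ((R + t S) J) = det (S J) * N.charpoly(t)`, which has finitely many zeros.
  set N := -((Matrix.of S * J)⁻¹ * (Matrix.of R * J)) with hN
  have hsub : {t : ℝ | ¬ (Matrix.of (R + t • S) * J).det ≠ 0} ⊆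
      (fun t : ℝ => (t : ℂ)) ⁻¹' {t | N.charpoly.IsRoot t} := by
    intro t ht
    have ht' : (Matrix.of (R + t • S) * J).det = 0 := not_not.1 ht
    have hfac : Matrix.of (R + t • S) * J =
        (Matrix.of S * J) * (Matrix.scalar σ (t : ℂ) - N) := by
      rw [hN, sub_neg_eq_add, mul_add, ← Matrix.mul_assoc (Matrix.of S * J),
        Matrix.mul_nonsing_inv _ (isUnit_iff_ne_zero.2 hS), Matrix.one_mul]
      have h1 : Matrix.of (R + t • S) = Matrix.of R + (t : ℂ) • Matrix.of S := by
        ext a e; simp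
      rw [h1, Matrix.add_mul, Matrix.smul_mul, Matrix.scalar_apply,
        ← Matrix.smul_one_eq_diagonal, Matrix.mul_smul, Matrix.mul_one, add_comm]
    rw [hfac, Matrix.det_mul] at ht'
    have h2 := (mul_eq_zero.1 ht').resolve_left hS
    change Polynomial.eval (t : ℂ) N.charpoly = 0
    rwa [Matrix.eval_charpoly]
  have hfin : {t : ℝ | ¬ (Matrix.of (R + t • S) * J).det ≠ 0}.Finite :=
    ((Polynomial.finite_setOfPred_isRoot N.charpoly_monic.ne_zero).preimage
      Complex.ofReal_injective.injOn).subset hsub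
  exact MeasureTheory.measure_mono_null (fun t ht => ht) (hfin.measure_zero _)

end Subsystems

/-! ### Specializing the deflated system along an algebra homomorphism. -/

section Specialization

variable {n δ : ℕ} {α : Fin δ → Fin n →₀ ℕ} {R : Type*} [CommRing R] [Algebra ℂ R]
  (Φ : MvPolynomial (Var α) ℂ →ₐ[ℂ] R)

/-- The parametric multiplication matrices specialized along `Φ`. -/
def specMatrix (i : Fin n) : Matrix (Fin δ) (Fin δ) R :=
  Φ.mapMatrix (paramMatrix ℂ α i)

theorem specMatrix_apply (i : Fin n) (j k : Fin δ) :
    specMatrix Φ i j k = Φ (paramMatrix ℂ α i j k) := rfl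

theorem specMatrix_lower (i : Fin n) : IsLowerBy 1 (specMatrix Φ i) := by
  intro j k h
  have hkj : ¬ k < j := by rw [Fin.lt_def]; omega
  simp [specMatrix_apply, paramMatrix, hkj]

theorem spec_paramMatrixPow (γ : Fin n →₀ ℕ) (j k : Fin δ) :
    Φ (paramMatrixPow ℂ α γ j k) = multiPow (specMatrix Φ) γ j k :=
  congrFun (congrFun (map_multiPow Φ.mapMatrix (paramMatrix ℂ α) γ) j) k

theorem spec_rename_inl (p : MvPolynomial (Fin n) ℂ) :
    Φ (rename Sum.inl p) = aeval (fun i => Φ (X (Sum.inl i))) p := by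
  have h : Φ.comp (rename Sum.inl) = aeval fun i => Φ (X (Sum.inl i)) := by
    apply MvPolynomial.algHom_ext
    intro i
    simp
  exact DFunLike.congr_fun h p

variable [NeZero δ]

theorem spec_paramNormalForm (p : MvPolynomial (Fin n) ℂ) (j : Fin δ) :
    Φ (paramNormalForm α p j) =
      (taylorMatrix (fun i => Φ (X (Sum.inl i))) (specMatrix Φ) p).col 0 j := by
  rw [Matrix.col_apply, paramNormalForm, taylorMatrix, map_sum, Matrix.sum_apply]
  refine Finset.sum_congr rfl fun d _ => ?_
  rw [map_sum, Matrix.sum_apply]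
  refine Finset.sum_congr rfl fun γ _ => ?_
  rw [map_mul, spec_paramMatrixPow, ← smul_eq_C_mul, map_smul, spec_rename_inl,
    Matrix.smul_apply, smul_eq_mul]

theorem spec_commutator {N : ℕ} (F : Fin N → MvPolynomial (Fin n) ℂ) (a b : Fin n)
    (j k : Fin δ) : Φ (deflatedSystem F α (Sum.inr ((a, b), j, k))) =
      (specMatrix Φ a * specMatrix Φ b - specMatrix Φ b * specMatrix Φ a) j k := by
  change (Φ.mapMatrix (paramMatrix ℂ α a * paramMatrix ℂ α b -
    paramMatrix ℂ α b * paramMatrix ℂ α a)) j k = _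
  rw [map_sub, map_mul, map_mul]
  rfl

theorem specMatrix_commute {N : ℕ} {F : Fin N → MvPolynomial (Fin n) ℂ}
    (h : ∀ e, Φ (deflatedSystem F α e) = 0) (a b : Fin n) :
    Commute (specMatrix Φ a) (specMatrix Φ b) := by
  rw [commute_iff_eq, ← sub_eq_zero]
  ext j k
  rw [← spec_commutator Φ F, h]
  rfl

end Specialization

/-! ### Base change of the deflated system along a field homomorphism. -/

section BaseChange

variable {K L : Type*} [Field K] [Field L] (φ : K →+* L) {n δ : ℕ} (α : Fin δ → Fin n →₀ ℕ)

theorem map_paramMatrix (i : Fin n) :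
    (map φ : MvPolynomial (Var α) K →+* _).mapMatrix (paramMatrix K α i) = paramMatrix L α i := by
  ext1 j k
  simp only [paramMatrix, RingHom.mapMatrix_apply, Matrix.map_apply, Matrix.of_apply]
  split_ifs <;> simp

theorem map_paramMatrixPow (γ : Fin n →₀ ℕ) :
    (map φ : MvPolynomial (Var α) K →+* _).mapMatrix (paramMatrixPow K α γ) =
      paramMatrixPow L α γ := by
  have h := map_multiPow (map φ : MvPolynomial (Var α) K →+* _).mapMatrix (paramMatrix K α) γ
  simp only [map_paramMatrix] at h
  exact h

theorem map_deflatedSystem [NeZero δ] {N : ℕ} (f : Fin N → MvPolynomial (Fin n) K)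
    (e : Eqn n N δ) :
    map φ (deflatedSystem f α e) = deflatedSystem (fun k => map φ (f k)) α e := by
  rcases e with ⟨k, j⟩ | ⟨⟨a, b⟩, j, k⟩
  · simp only [deflatedSystem, paramNormalForm, map_sum, map_mul, map_C, map_inv₀, map_natCast,
      map_rename, iterPderiv_map]
    refine Finset.sum_congr rfl fun d _ => Finset.sum_congr rfl fun γ _ => ?_
    rw [← map_paramMatrixPow φ]
    rfl
  · simp only [deflatedSystem]
    rw [← map_paramMatrix φ α a, ← map_paramMatrix φ α b, ← map_mul, ← map_mul, ← map_sub]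
    rfl

end BaseChange

/-! ### Tangent vectors as points over the dual numbers. -/

section DirectionalDerivative

variable {σ : Type*} [Fintype σ]

/-- Evaluation at the tangent vector `x + ε u`. -/
def tangentEval (x u : σ → ℂ) : MvPolynomial σ ℂ →ₐ[ℂ] DualNumber ℂ :=
  aeval fun b => TrivSqZeroExt.inl (x b) + TrivSqZeroExt.inr (u b)

omit [Fintype σ] in
theorem fst_tangentEval (x u : σ → ℂ) (q : MvPolynomial σ ℂ) :
    (tangentEval x u q).fst = eval x q := by
  have h : (TrivSqZeroExt.fstHom ℂ ℂ ℂ).comp (tangentEval x u) = aeval x := by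
    apply MvPolynomial.algHom_ext
    intro b
    simp [tangentEval]
  rw [← aeval_eq_eval]
  exact DFunLike.congr_fun h q

/-- With `fst_tangentEval`, this turns kernel vectors of the Jacobian at a root into solutions over
the dual numbers. -/
theorem snd_tangentEval (x u : σ → ℂ) (q : MvPolynomial σ ℂ) :
    (tangentEval x u q).snd = ∑ b, eval x (pderiv b q) * u b := by
  classical
  induction q using MvPolynomial.induction_on with
  | C a => simp [tangentEval, TrivSqZeroExt.algebraMap_eq_inl]
  | add p q hp hq => simp [hp, hq, add_mul, Finset.sum_add_distrib]
  | mul_X p i hp =>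
    have hX : tangentEval x u (X i) = TrivSqZeroExt.inl (x i) + TrivSqZeroExt.inr (u i) := by
      simp [tangentEval]
    rw [map_mul, TrivSqZeroExt.snd_mul, hp, fst_tangentEval, hX]
    simp [pderiv_X, Pi.single_apply, add_mul, Finset.sum_add_distrib]
    have h1 : ∀ b, eval x (if i = b then p else 0) = if i = b then eval x p else 0 := fun b => by
      split_ifs <;> simp
    simp only [h1, ite_mul, zero_mul, Finset.sum_ite_eq, Finset.mem_univ, if_true, Finset.sum_mul]
    congr 1
    exact Finset.sum_congr rfl fun b _ => by ring

end DirectionalDerivative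

/-! ### Injectivity of the Jacobian of the deflated system. -/

section Deflation

variable {n δ N : ℕ} [NeZero δ] {F : Fin N → MvPolynomial (Fin n) ℂ} {ξ : Fin n → ℂ}
  {α : Fin δ → Fin n →₀ ℕ} {Λ : Fin δ → MvPolynomial (Fin n) ℂ}

namespace IsPrimalDualPair

variable (hB : IsPrimalDualPair F ξ α Λ)
include hB

theorem eval_paramMatrix (i : Fin n) (j k : Fin δ) :
    eval (rootPoint ξ α Λ) (paramMatrix ℂ α i j k) = multMatrix α Λ i j k := by
  simp only [paramMatrix, Matrix.of_apply]
  split_ifs with hk hj hE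
  · rw [hB.multMatrix_of_eq hj, if_pos rfl, map_one]
  · obtain ⟨l, hl⟩ := hE
    rw [hB.multMatrix_of_eq hl, if_neg, map_zero]
    rintro rfl
    exact hj hl
  · rw [eval_X]
    rfl
  · rw [map_zero, hB.multMatrix_lower i j k]
    rw [Fin.lt_def] at hk
    omega

theorem specMatrix_rootPoint :
    specMatrix (aeval (rootPoint ξ α Λ) : MvPolynomial (Var α) ℂ →ₐ[ℂ] ℂ) = multMatrix α Λ := by
  funext i
  ext j k
  rw [specMatrix_apply, aeval_eq_eval]
  exact hB.eval_paramMatrix i j k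

theorem eval_paramMatrixPow (γ : Fin n →₀ ℕ) (j : Fin δ) :
    eval (rootPoint ξ α Λ) (paramMatrixPow ℂ α γ j 0) = dualCoeff Λ j γ := by
  rw [← hB.multiPow_apply_zero, ← hB.specMatrix_rootPoint, ← spec_paramMatrixPow, aeval_eq_eval]

theorem eval_paramNormalForm (p : MvPolynomial (Fin n) ℂ) (j : Fin δ) :
    eval (rootPoint ξ α Λ) (paramNormalForm α p j) = dualValues ξ Λ p j := by
  have h := spec_paramNormalForm
    (aeval (rootPoint ξ α Λ) : MvPolynomial (Var α) ℂ →ₐ[ℂ] ℂ) p j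
  rw [hB.specMatrix_rootPoint] at h
  have hz : (fun i : Fin n => (aeval (rootPoint ξ α Λ) : MvPolynomial (Var α) ℂ →ₐ[ℂ] ℂ)
      (X (Sum.inl i))) = ξ := by
    funext i
    simp [rootPoint]
  rw [hz, ← hB.dualValues_eq_taylorMatrix] at h
  rwa [aeval_eq_eval] at h

theorem eval_deflatedSystem (e : Eqn n N δ) :
    eval (rootPoint ξ α Λ) (deflatedSystem F α e) = 0 := by
  rcases e with ⟨k, j⟩ | ⟨⟨a, b⟩, j, k⟩
  · exact (hB.eval_paramNormalForm _ j).trans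
      (congrFun (hB.dualValues_eq_zero_of_mem_span (Ideal.subset_span ⟨k, rfl⟩)) j)
  · have h := spec_commutator (aeval (rootPoint ξ α Λ) : MvPolynomial (Var α) ℂ →ₐ[ℂ] ℂ) F a b j k
    rw [hB.specMatrix_rootPoint, (hB.multMatrix_commute a b).eq, sub_self] at h
    rw [aeval_eq_eval] at h
    exact h

/-- A tangent vector to the deflated system at the root deforms the multiplication matrices by
a commutator and a translation. -/
theorem exists_commutator_eq {u : Var α → ℂ}
    (hu : ∀ e, tangentEval (rootPoint ξ α Λ) u (deflatedSystem F α e) = 0) :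
    ∃ T : Matrix (Fin δ) (Fin δ) ℂ, (∀ j, T j 0 = 0) ∧ ∀ i j k,
      (T * multMatrix α Λ i) j k = u (Sum.inl i) * (if j = k then 1 else 0) +
        (multMatrix α Λ i * T) j k +
        (specMatrix (tangentEval (rootPoint ξ α Λ) u) i j k).snd := by
  set Φ := tangentEval (rootPoint ξ α Λ) u with hΦ
  set z : Fin n → DualNumber ℂ := fun i => Φ (X (Sum.inl i)) with hz
  have hzi : ∀ i, z i = TrivSqZeroExt.inl (ξ i) + TrivSqZeroExt.inr (u (Sum.inl i)) := by
    intro i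
    simp [hz, hΦ, tangentEval, rootPoint]
  have hlow := specMatrix_lower Φ
  have hcom := specMatrix_commute Φ hu
  set A := specMatrix Φ with hA
  set φ : MvPolynomial (Fin n) ℂ → Fin δ → DualNumber ℂ := fun p => (taylorMatrix z A p).col 0
    with hφ
  have hφfst : ∀ p j, (φ p j).fst = dualValues ξ Λ p j := by
    intro p j
    rw [hφ, ← hB.eval_paramNormalForm, ← fst_tangentEval _ u, ← hΦ, spec_paramNormalForm]
  have hAfst : ∀ i j k, (A i j k).fst = multMatrix α Λ i j k := by
    intro i j k
    rw [hA, specMatrix_apply, hΦ, fst_tangentEval, hB.eval_paramMatrix]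
  have hzero : ∀ q ∈ primaryComponent (Ideal.span (Set.range F)) ξ, φ q = 0 := by
    intro q hq
    refine taylorMatrix_col_eq_zero_of_mem hlow hcom (F := F) (fun k => ?_) (fun p hp => ?_) hq
    · funext j
      rw [← spec_paramNormalForm]
      exact hu (Sum.inl (k, j))
    -- A dual number is a unit exactly when its `ε`-free part is, so nonvanishing at `ξ` suffices.
    · rw [← spec_rename_inl, TrivSqZeroExt.isUnit_iff_isUnit_fst, fst_tangentEval, eval_rename]
      exact hp.isUnit
  have hφadd : ∀ p q, φ (p + q) = φ p + φ q := fun p q => by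
    simp only [hφ, taylorMatrix_add]; rfl
  have hφsmul : ∀ (c : ℂ) p, φ (c • p) = c • φ p := fun c p => by
    simp only [hφ, taylorMatrix_smul]; rfl
  let φl : MvPolynomial (Fin n) ℂ →ₗ[ℂ] Fin δ → DualNumber ℂ :=
    { toFun := φ, map_add' := hφadd, map_smul' := hφsmul }
  -- Since `φ` kills `Q`, it is determined by its values on the primal basis.
  have hexp : ∀ p, φ p = ∑ k, dualValues ξ Λ p k • φ (shiftedMonomial ξ (α k)) := by
    intro p
    have h : φl _ = 0 := hzero _ (hB.sub_normalForm_mem p)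
    rw [map_sub, sub_eq_zero, map_sum] at h
    simp only [map_smul] at h
    exact h
  have hφX : ∀ i p, φ (X i * p) = z i • φ p + (A i).mulVec (φ p) := by
    intro i p
    simp only [hφ]
    rw [taylorMatrix_X_mul hlow hcom, add_mul, Matrix.smul_mul, one_mul]
    rfl
  -- `T` is the `ε`-part of the map induced on `ℂ[x]/Q`.
  refine ⟨Matrix.of fun j k => (φ (shiftedMonomial ξ (α k)) j).snd, fun j => ?_,
    fun i j k => ?_⟩
  · rw [Matrix.of_apply, hB.exponent_zero, shiftedMonomial_zero]
    simp only [hφ, taylorMatrix_one hlow]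
    by_cases hj : j = 0
    · subst hj; simp
    · simp [hj]
  -- The image of `x_i (x - ξ)^{α_k}` is computed through the primal basis and through the
  -- recursion. In the `ε`-parts the terms `ξ_i T` cancel.
  · have h := congrFun (hφX i (shiftedMonomial ξ (α k))) j
    rw [hexp, hB.dualValues_X_mul, hB.dualValues_shiftedMonomial] at h
    have h2 := congrArg TrivSqZeroExt.snd h
    simp only [Matrix.mulVec, dotProduct, Finset.sum_apply, Pi.smul_apply, Pi.add_apply,
      TrivSqZeroExt.snd_sum, TrivSqZeroExt.snd_smul, TrivSqZeroExt.snd_add, smul_eq_mul,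
      TrivSqZeroExt.snd_mul, hzi, hφfst, hAfst, hB.dualValues_shiftedMonomial,
      TrivSqZeroExt.fst_inl, TrivSqZeroExt.fst_inr,
      TrivSqZeroExt.snd_inl, TrivSqZeroExt.snd_inr, Pi.single_apply, add_mul,
      Finset.sum_add_distrib, MulOpposite.smul_eq_mul_unop, MulOpposite.unop_op] at h2
    simp only [Matrix.mul_apply, Matrix.of_apply]
    simp at h2
    simp only [mul_comm _ (multMatrix α Λ i _ k), mul_ite, mul_one, mul_zero]
    linear_combination h2

/-- The deflated system has no nonzero tangent vector at the root. -/
theorem jacobian_injective {u : Var α → ℂ}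
    (hu : ∀ e, tangentEval (rootPoint ξ α Λ) u (deflatedSystem F α e) = 0) : u = 0 := by
  obtain ⟨T, hT0, hT⟩ := hB.exists_commutator_eq hu
  set Φ := tangentEval (rootPoint ξ α Λ) u with hΦ
  have hv : ∀ i, u (Sum.inl i) = 0 := by
    intro i
    -- Trace of the relation: the deformation has zero diagonal and the traces of `T M_i` and `M_i
    -- T` agree, which leaves `δ * u_i = 0`.
    have h : ∑ j, (T * multMatrix α Λ i) j j = ∑ j, (u (Sum.inl i) +
        (multMatrix α Λ i * T) j j) := by
      refine Finset.sum_congr rfl fun j _ => ?_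
      rw [hT, specMatrix_lower Φ i j j (by omega)]
      simp
    have htr := Matrix.trace_mul_comm T (multMatrix α Λ i)
    rw [Matrix.trace, Matrix.trace] at htr
    simp only [Matrix.diag_apply] at htr
    rw [Finset.sum_add_distrib, htr] at h
    have hδ : (δ : ℂ) ≠ 0 := Nat.cast_ne_zero.2 (NeZero.ne δ)
    simpa [hδ] using h
  have hconst : ∀ i j k, (∃ l, α l = α k + Finsupp.single i 1) →
      (specMatrix Φ i j k).snd = 0 := by
    intro i j k hE
    rw [specMatrix_apply]
    simp only [paramMatrix, Matrix.of_apply]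
    split_ifs <;> simp
  -- Induction along connectedness to `1`: if `α_k = α_l + e_i`, then `M_i` sends `e_l` to `e_k`,
  -- and column `l` of the parametric matrix is constant, so column `k` of `T` is `M_i` applied to
  -- column `l`.
  have hcol : ∀ d k, (α k).degree = d → ∀ j, T j k = 0 := by
    intro d
    induction d with
    | zero =>
      intro k hk j
      have h0 : α k = α 0 := by rw [(Finsupp.degree_eq_zero_iff _).1 hk, hB.exponent_zero]
      rw [hB.exponent_injective h0, hT0]
    | succ d ih =>
      intro k hk j
      have hne : α k ≠ 0 := by rintro h; simp [h] at hk
      obtain ⟨l, i, hl⟩ := hB.connected k hne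
      have hld : (α l).degree = d := by
        rw [hl, map_add, Finsupp.degree_single] at hk
        omega
      have h := hT i j l
      rw [hv, hconst i j l ⟨k, hl⟩, Matrix.mul_apply, Matrix.mul_apply] at h
      simpa [hB.multMatrix_of_eq hl, ih l hld] using h
  have hTz : T = 0 := by
    ext j k
    exact hcol _ k rfl j
  funext b
  -- With `T = 0` and `u_i = 0` the deformation vanishes, and each parameter occurs as an entry of
  -- some matrix.
  rcases b with i | ⟨⟨j, β⟩, hE, k, hk, i, hβ⟩
  · exact hv i
  · have h := hT i j k
    rw [hTz, hv, zero_mul, mul_zero, zero_mul] at h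
    simp only [Matrix.zero_apply, zero_add] at h
    dsimp only at hβ hk hE
    subst hβ
    have hj : ¬ α j = α k + Finsupp.single i 1 := fun hj => hE ⟨j, hj⟩
    rw [specMatrix_apply] at h
    simp only [paramMatrix, Matrix.of_apply, dif_pos hk, if_neg hj, dif_neg hE] at h
    rw [hΦ, tangentEval, aeval_X] at h
    simpa using h.symm

end IsPrimalDualPair

end Deflation

end MultStruct

end

/-! ### Assembly of the corollary. -/

theorem mainTheorem5 {K : Type*} [Field K] [Algebra K ℂ] {n N δ : ℕ} [NeZero δ]
    (f : Fin N → MvPolynomial (Fin n) K) (ξ : Fin n → ℂ)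
    (hξ : MultStruct.IsIsolatedRoot (fun k => MvPolynomial.map (algebraMap K ℂ) (f k)) ξ)
    (α : Fin δ → Fin n →₀ ℕ) (Λ : Fin δ → MvPolynomial (Fin n) ℂ)
    (hB : MultStruct.IsPrimalDualPair
      (fun k => MvPolynomial.map (algebraMap K ℂ) (f k)) ξ α Λ)
    (P : MultStruct.Eqn n N δ → MvPolynomial (MultStruct.Var α) ℂ)
    (hP : P = fun e => MvPolynomial.map (algebraMap K ℂ) (MultStruct.deflatedSystem f α e))
    (x : MultStruct.Var α → ℂ) (hx : x = MultStruct.rootPoint ξ α Λ) :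
    -- a generic square subsystem has a simple root at `(ξ, ν)`
    (∃ D : MvPolynomial (MultStruct.Var α × MultStruct.Eqn n N δ) ℂ,
      D ≠ 0 ∧ D.totalDegree ≤ Fintype.card (MultStruct.Var α) ∧
      ∀ R : MultStruct.Var α → MultStruct.Eqn n N δ → ℂ,
        MvPolynomial.eval (fun q => R q.1 q.2) D ≠ 0 →
          MultStruct.IsSimpleRoot (MultStruct.squareSubsystem P R) x) ∧
    -- a random square subsystem has a simple root at `(ξ, ν)` with probability one
    (∀ᵐ R : MultStruct.Var α → MultStruct.Eqn n N δ → ℂ ∂MeasureTheory.volume,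
      MultStruct.IsSimpleRoot (MultStruct.squareSubsystem P R) x) ∧
    -- some selection of as many equations as there are variables has a simple root at `(ξ, ν)`
    (∃ s : MultStruct.Var α ↪ MultStruct.Eqn n N δ,
      MultStruct.IsSimpleRoot (fun v => P (s v)) x) ∧
    -- Newton's method refines approximations of `(ξ, ν)`, and the powers of the multiplication
    -- matrices update all other coefficients of the dual basis
    (∀ (R : MultStruct.Var α → MultStruct.Eqn n N δ → ℂ)
      (G : MultStruct.Var α → MvPolynomial (MultStruct.Var α) ℂ),
      G = MultStruct.squareSubsystem P R → MultStruct.IsSimpleRoot G x →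
      ∃ r > (0 : ℝ), ∃ c > (0 : ℝ), ∀ y ∈ Metric.ball x r,
        (∀ m : ℕ,
          (MultStruct.jacobianAt G ((MultStruct.newtonStep G)^[m] y)).det ≠ 0 ∧
          ‖(MultStruct.newtonStep G)^[m + 1] y - x‖ ≤
            c * ‖(MultStruct.newtonStep G)^[m] y - x‖ ^ 2 ∧
          ‖(MultStruct.newtonStep G)^[m] y - x‖ ≤ (1 / 2 : ℝ) ^ (2 ^ m - 1) * ‖y - x‖) ∧
        ∀ (j : Fin δ) (γ : Fin n →₀ ℕ),
          Filter.Tendsto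
            (fun m : ℕ => MvPolynomial.eval ((MultStruct.newtonStep G)^[m] y)
              (MultStruct.paramMatrixPow ℂ α γ j 0))
            Filter.atTop (nhds (MultStruct.dualCoeff Λ j γ))) ∧
    -- the coefficients on `E × ∂(E)` are the entries of the multiplication matrices at `ν`
    (∀ (i : Fin n) (j k : Fin δ),
      MvPolynomial.eval x (MultStruct.paramMatrix ℂ α i j k) =
        MultStruct.dualCoeff Λ j (α k + Finsupp.single i 1)) ∧
    -- all coefficients are recovered from the powers of the multiplication matrices at `ν`
    (∀ (j : Fin δ) (γ : Fin n →₀ ℕ),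
      MvPolynomial.eval x (MultStruct.paramMatrixPow ℂ α γ j 0) =
        MultStruct.dualCoeff Λ j γ) := by
  classical
  have hPe : P = MultStruct.deflatedSystem
      (fun k => MvPolynomial.map (algebraMap K ℂ) (f k)) α := by
    rw [hP]
    funext e
    exact MultStruct.map_deflatedSystem _ _ _ _
  have hroot : ∀ e, MvPolynomial.eval x (P e) = 0 := by
    intro e
    rw [hPe, hx]
    exact hB.eval_deflatedSystem e
  set J : Matrix (MultStruct.Eqn n N δ) (MultStruct.Var α) ℂ :=
    Matrix.of fun e b => MvPolynomial.eval x (MvPolynomial.pderiv b (P e)) with hJ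
  have hinj : ∀ u, J.mulVec u = 0 → u = 0 := by
    intro u hu
    refine hB.jacobian_injective fun e => TrivSqZeroExt.ext ?_ ?_
    · rw [MultStruct.fst_tangentEval]
      exact hB.eval_deflatedSystem e
    · rw [MultStruct.snd_tangentEval, ← hx, ← hPe]
      exact congrFun hu e
  obtain ⟨s, hs⟩ := MultStruct.exists_embedding_det_ne_zero J hinj
  have hS := hs
  -- The 0-1 matrix selecting the rows `s` is a point where the generic minor does not vanish.
  rw [← MultStruct.selection_mul] at hS
  refine ⟨⟨MultStruct.genericMinor J, ?_, MultStruct.totalDegree_genericMinor_le J,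
    fun R hR => ?_⟩, ?_, ⟨s, ?_⟩, ?_, ?_, ?_⟩
  · intro h0
    rw [← MultStruct.eval_genericMinor J, h0, map_zero] at hS
    exact hS rfl
  · rw [MultStruct.eval_genericMinor] at hR
    exact MultStruct.isSimpleRoot_squareSubsystem hroot hR
  · filter_upwards [MultStruct.ae_det_mul_ne_zero J _ hS] with R hR
    exact MultStruct.isSimpleRoot_squareSubsystem hroot hR
  · exact MultStruct.isSimpleRoot_of_det_ne_zero (fun v => hroot (s v)) hs
  · intro R G _ hGx
    obtain ⟨r, hr, c, hc, h⟩ := MultStruct.exists_newton_ball hGx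
    refine ⟨r, hr, c, hc, fun y hy => ⟨fun m => ?_, fun j γ => ?_⟩⟩
    · convert h y hy m
    · rw [← hB.eval_paramMatrixPow γ j, ← hx]
      refine ((MvPolynomial.continuous_eval _).tendsto x).comp ?_
      have hlim := MultStruct.tendsto_of_quadratic_bound fun m => (h y hy m).2.2
      convert hlim
  · intro i j k
    rw [hx]
    exact hB.eval_paramMatrix i j k
  · intro j γ
    rw [hx]
    exact hB.eval_paramMatrixPow γ j
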